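/- Let $d\ge 1$, $\mathcal I=\{1,\dots,d\}$, and let $\|\cdot\|$ be the sup norm on $\mathbb R^d$. On a probability space with an increasing family of $\sigma$-fields $\{\mathcal F_n\}_{n\ge 0}$, let $x_n, M_n, \epsilon_n$ be $\mathbb R^d$-valued random vectors and let $Y_n$ be random nonempty subsets of $\mathcal I$, with $x_n, Y_n, M_n, \epsilon_n$ all $\mathcal F_n$-measurable for $n\ge 0$. Let $\alpha_n>0$ $(n\ge 0)$ be deterministic stepsizes and $h:\mathbb R^d\to\mathbb R^d$. Put $\nu(n,i)=\sum_{k=0}^{n-1}\mathbf 1\{i\in Y_k\}$, and suppose that for all $n\ge 0$ $$x_{n+1}(i)=x_n(i)+\alpha_{\nu(n,i)}\bigl(h_i(x_n)+M_{n+1}(i)+\epsilon_{n+1}(i)\bigr)\ \ (i\in Y_n),\qquad x_{n+1}(i)=x_n(i)\ \ (i\notin Y_n).$$ Assume the following. 1. (Drift) $h$ is Lipschitz continuous; as $c\uparrow\infty$, the functions $h_c(x)=h(cx)/c$ converge uniformly on compact sets to a function $h_\infty:\mathbb R^d\to\mathbb R^d$; and the ODE $\dot x(t)=h_\infty(x(t))$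 has the origin as its unique globally asymptotically stable equilibrium (i.e. an equilibrium that is Lyapunov stable and to which every solution on $[0,\infty)$ converges as $t\to\infty$). 2. (Noise) For all $n\ge 0$: $\mathbb E\|M_{n+1}\|<\infty$, $\mathbb E[M_{n+1}\mid\mathcal F_n]=0$ and $\mathbb E[\|M_{n+1}\|^2\mid\mathcal F_n]\le K_n(1+\|x_n\|^2)$ a.s., where $K_n\ge 0$ is $\mathcal F_n$-measurable and $\sup_n K_n<\infty$ a.s.; and $\|\epsilon_{n+1}\|\le\delta_{n+1}(1+\|x_n\|)$ a.s., where $\delta_{n+1}$ is $\mathcal F_{n+1}$-measurable and $\delta_n\to 0$ a.s. 3. (Stepsizes) $\sum_n\alpha_n=\infty$, $\sum_n\alpha_n^2<\infty$, and $\alpha_{n+1}\le\alpha_n$ for all sufficiently large $n$; and for each $x\in(0,1)$, $\sup_n \alpha_{[xn]}/\alpha_n<\infty$ and, as $n\to\infty$, $\sum_{k=0}^{[yn]}\alpha_k\big/\sum_{k=0}^{n}\alpha_k\to 1$ uniformly in $y\in[x,1]$, where $[\cdot]$ denotes the integral part. 4. (Partial asynchrony) There is a deterministic $\Delta>0$ such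 that $\liminf_{n\to\infty}\nu(n,i)/n\ge\Delta$ a.s. for all $i\in\mathcal I$; and, with $N(n,x)=\min\{m>n:\sum_{k=n}^m\alpha_k\ge x\}$, for each $x>0$ and all $i,j\in\mathcal I$ the (finite) limit $$\lim_{n\to\infty}\frac{\sum_{k=\nu(n,i)}^{\nu(N(n,x),i)}\alpha_k}{\sum_{k=\nu(n,j)}^{\nu(N(n,x),j)}\alpha_k}$$ exists a.s. Then the sequence $\{x_n\}$ is bounded almost surely, i.e. $\sup_{n\ge 0}\|x_n\|<\infty$ a.s. -/

import Mathlib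

open MeasureTheory ProbabilityTheory Filter Topology

namespace AsyncSA

/-- `x` solves the autonomous ODE `x' = g x` on `[0, ∞)` (one-sided derivative at `0`). -/
def IsSolution {d : ℕ} (g : (Fin d → ℝ) → (Fin d → ℝ)) (x : ℝ → Fin d → ℝ) : Prop :=
  ∀ t : ℝ, 0 ≤ t → HasDerivWithinAt x (g (x t)) (Set.Ici 0) t

/-- `z` is a globally asymptotically stable equilibrium of `x' = g x`: an equilibrium that is
Lyapunov stable and attracts every solution. -/
structure IsGASEquilibrium {d : ℕ} (g : (Fin d → ℝ) → (Fin d → ℝ)) (z : Fin d → ℝ) : Prop where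
  equilibrium : g z = 0
  stable : ∀ ε : ℝ, 0 < ε → ∃ η : ℝ, 0 < η ∧ ∀ x : ℝ → Fin d → ℝ, IsSolution g x →
    ‖x 0 - z‖ < η → ∀ t : ℝ, 0 ≤ t → ‖x t - z‖ < ε
  attractive : ∀ x : ℝ → Fin d → ℝ, IsSolution g x → Tendsto x atTop (𝓝 z)

/-- The Borkar–Meyn stability criterion for `h`, with scaling limit `hInf`. -/
structure DriftCondition {d : ℕ} (h hInf : (Fin d → ℝ) → (Fin d → ℝ)) : Prop where
  lipschitz : ∃ L : NNReal, LipschitzWith L h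
  scaling_limit : ∀ S : Set (Fin d → ℝ), IsCompact S →
    TendstoUniformlyOn (fun (c : ℝ) (x : Fin d → ℝ) => c⁻¹ • h (c • x)) hInf atTop S
  gas : IsGASEquilibrium hInf 0
  gas_unique : ∀ z : Fin d → ℝ, IsGASEquilibrium hInf z → z = 0

/-- `ν(n, i)`: the number of updates of component `i` prior to iteration `n`. -/
def updateCount {Ω : Type*} {d : ℕ} (Y : ℕ → Ω → Finset (Fin d)) (n : ℕ) (i : Fin d) (ω : Ω) : ℕ :=
  ∑ k ∈ Finset.range n, if i ∈ Y k ω then 1 else 0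

/-- The asynchronous stochastic approximation scheme with stepsizes `α`, drift `h`, update sets `Y`,
centered noise `M` and biased noise `ε`; all the processes are adapted to the filtration `F`. -/
structure IsAsyncSA {Ω : Type*} {mΩ : MeasurableSpace Ω} {d : ℕ} (F : Filtration ℕ mΩ)
    (α : ℕ → ℝ) (h : (Fin d → ℝ) → (Fin d → ℝ)) (Y : ℕ → Ω → Finset (Fin d))
    (M ε x : ℕ → Ω → Fin d → ℝ) : Prop where
  adapted_x : ∀ n, Measurable[F n] (x n)
  adapted_Y : ∀ n i, MeasurableSet[F n] {ω | i ∈ Y n ω}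
  adapted_M : ∀ n, Measurable[F n] (M n)
  adapted_ε : ∀ n, Measurable[F n] (ε n)
  nonempty : ∀ n ω, (Y n ω).Nonempty
  update : ∀ n ω, ∀ i ∈ Y n ω,
    x (n + 1) ω i =
      x n ω i + α (updateCount Y n i ω) * (h (x n ω) i + M (n + 1) ω i + ε (n + 1) ω i)
  no_update : ∀ n ω, ∀ i ∉ Y n ω, x (n + 1) ω i = x n ω i

/-- Conditions on the noise terms. The conditional second moment is the conditional expectation of
a `[0, ∞]`-valued function, so that `‖M (n + 1)‖ ^ 2` need not be integrable. -/
structure NoiseCondition {Ω : Type*} {mΩ : MeasurableSpace Ω} {d : ℕ} (μ : Measure Ω)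
    (F : Filtration ℕ mΩ) (M ε x : ℕ → Ω → Fin d → ℝ) (K δ : ℕ → Ω → ℝ) : Prop where
  integrable : ∀ n, Integrable (M (n + 1)) μ
  condExp_eq_zero : ∀ n, μ[M (n + 1) | F n] =ᵐ[μ] 0
  measurable_K : ∀ n, Measurable[F n] (K n)
  K_nonneg : ∀ n ω, 0 ≤ K n ω
  condVar_le : ∀ n, ∀ᵐ ω ∂μ,
    condLExp (F n) μ (fun ω' => ENNReal.ofReal (‖M (n + 1) ω'‖ ^ 2)) ω
      ≤ ENNReal.ofReal (K n ω * (1 + ‖x n ω‖ ^ 2))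
  K_bounded : ∀ᵐ ω ∂μ, BddAbove (Set.range fun n => K n ω)
  measurable_δ : ∀ n, Measurable[F (n + 1)] (δ (n + 1))
  bias_le : ∀ n, ∀ᵐ ω ∂μ, ‖ε (n + 1) ω‖ ≤ δ (n + 1) ω * (1 + ‖x n ω‖)
  δ_tendsto : ∀ᵐ ω ∂μ, Tendsto (fun n => δ n ω) atTop (𝓝 0)

/-- Conditions on the stepsizes. -/
structure StepsizeCondition (α : ℕ → ℝ) : Prop where
  pos : ∀ n, 0 < α n
  sum_eq_top : Tendsto (fun n => ∑ k ∈ Finset.range n, α k) atTop atTop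
  summable_sq : Summable fun n => α n ^ 2
  eventually_noninc : ∀ᶠ n in atTop, α (n + 1) ≤ α n
  ratio_bounded : ∀ x : ℝ, 0 < x → x < 1 →
    BddAbove (Set.range fun n : ℕ => α ⌊x * n⌋₊ / α n)
  partial_sums : ∀ x : ℝ, 0 < x → x < 1 →
    TendstoUniformlyOn
      (fun (n : ℕ) (y : ℝ) =>
        (∑ k ∈ Finset.range (⌊y * n⌋₊ + 1), α k) / ∑ k ∈ Finset.range (n + 1), α k)
      (fun _ => 1) atTop (Set.Icc x 1)

/-- `N(n, x) = min {m > n : ∑_{k=n}^m α_k ≥ x}`; the set is non-empty when `∑ α_k = ∞`. -/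
noncomputable def window (α : ℕ → ℝ) (n : ℕ) (x : ℝ) : ℕ :=
  sInf {m : ℕ | n < m ∧ x ≤ ∑ k ∈ Finset.Icc n m, α k}

/-- Partial asynchrony conditions on the update sets. -/
structure AsynchronyCondition {Ω : Type*} {mΩ : MeasurableSpace Ω} {d : ℕ} (μ : Measure Ω)
    (α : ℕ → ℝ) (Y : ℕ → Ω → Finset (Fin d)) : Prop where
  frequency : ∃ Δ : ℝ, 0 < Δ ∧ ∀ i : Fin d, ∀ᵐ ω ∂μ,
    Δ ≤ liminf (fun n : ℕ => (updateCount Y n i ω : ℝ) / n) atTop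
  balance : ∀ x : ℝ, 0 < x → ∀ i j : Fin d, ∀ᵐ ω ∂μ, ∃ l : ℝ,
    Tendsto
      (fun n : ℕ =>
        (∑ k ∈ Finset.Icc (updateCount Y n i ω) (updateCount Y (window α n x) i ω), α k) /
          ∑ k ∈ Finset.Icc (updateCount Y n j ω) (updateCount Y (window α n x) j ω), α k)
      atTop (𝓝 l)

end AsyncSA

/-! The proof is the Borkar–Meyn rescaling argument, with the components' local clocks shown to run
at equal speed. Time is cut into windows over which the stepsizes sum to about `d * T`. In a window
starting at `s` the iterates are divided by `r = max ‖x s‖ R`. For large `R` the rescaled drift is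
uniformly close to `hInf` on a ball, so the rescaled iterates follow a solution of `x' = hInf x`
started in the unit ball. Such solutions have norm below `1/4` after a time `T` common to all of
them (`IsGASEquilibrium.exists_uniform_time`). A tracking error of at most `1/4` then gives norm at
most `r / 2` at the end of the window, so `max ‖x s‖ R` never grows from one late window to the
next, and inside a window the iterates stay below `(B + 1) * r`.

Tracking is deterministic (`IsSolution.norm_sub_le_of_perturbed_euler`, `norm_le_on_window`) and
needs two inputs.

Equal clocks: the partial-sum condition makes each local clock asymptotic to the global one. If a
window ratio had a limit other than `1`, one component would gain a fixed factor on another in every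
late window, contradicting this (`not_eventually_window_sum_ge`). Hence clock differences over short
windows tend to `0`, and chaining short windows covers any bounded length.

Small noise: dividing by the size at the start of the window and truncating gives predictable
weights with bounded total conditional variance, so the weighted martingale converges almost surely
(`ae_exists_tendsto_noise`). The bound on earlier iterates of the window, available by induction,
shows that the truncation is inactive. -/

namespace AsyncSA

/-! ### Global solutions of Lipschitz ODEs and their basic estimates. -/

/-- Coordinatewise truncation to the sup-norm ball of radius `R`. -/
def clamp {d : ℕ} (R : ℝ) (x : Fin d → ℝ) : Fin d → ℝ := fun i => max (-R) (min R (x i))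

lemma norm_clamp_le {d : ℕ} {R : ℝ} (hR : 0 ≤ R) (x : Fin d → ℝ) : ‖clamp R x‖ ≤ R := by
  refine (pi_norm_le_iff_of_nonneg hR).2 fun i => ?_
  rw [Real.norm_eq_abs, abs_le]
  exact ⟨le_max_left _ _, max_le (by linarith) (min_le_left _ _)⟩

lemma clamp_eq_self {d : ℕ} {R : ℝ} {x : Fin d → ℝ} (hx : ‖x‖ ≤ R) : clamp R x = x := by
  funext i
  have h : |x i| ≤ R := (norm_le_pi_norm x i).trans hx
  obtain ⟨h1, h2⟩ := abs_le.1 h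
  simp [clamp, h1, h2]

lemma lipschitzWith_clamp {d : ℕ} (R : ℝ) : LipschitzWith 1 (clamp R : (Fin d → ℝ) → _) := by
  refine LipschitzWith.of_dist_le_mul fun x y => ?_
  rw [NNReal.coe_one, one_mul]
  refine (dist_pi_le_iff dist_nonneg).2 fun i => ?_
  refine le_trans ?_ (dist_le_pi_dist x y i)
  simp only [clamp, Real.dist_eq]
  exact (abs_max_sub_max_le_max _ _ _ _).trans
    (max_le (by simp) ((abs_min_sub_min_le_max _ _ _ _).trans (max_le (by simp) le_rfl)))

lemma norm_clamp_le_norm {d : ℕ} {R : ℝ} (hR : 0 ≤ R) (x : Fin d → ℝ) : ‖clamp R x‖ ≤ ‖x‖ := by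
  have h := (lipschitzWith_clamp R).dist_le_mul x 0
  rwa [clamp_eq_self (x := (0 : Fin d → ℝ)) (by simpa using hR), dist_zero_right, dist_zero_right,
    NNReal.coe_one, one_mul] at h

lemma norm_le_of_lipschitz {d : ℕ} {g : (Fin d → ℝ) → (Fin d → ℝ)} {L : NNReal}
    (hg : LipschitzWith L g) (hg0 : g 0 = 0) (x : Fin d → ℝ) : ‖g x‖ ≤ L * ‖x‖ := by
  simpa [hg0] using hg.dist_le_mul x 0

lemma hasDerivWithinAt_Ici_of_Icc {E : Type*} [NormedAddCommGroup E] [NormedSpace ℝ E]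
    {y : ℝ → E} {y' : E} {a b t : ℝ} (ht : t ∈ Set.Ico a b)
    (h : HasDerivWithinAt y y' (Set.Icc a b) t) : HasDerivWithinAt y y' (Set.Ici t) t := by
  refine h.mono_of_mem_nhdsWithin ?_
  exact mem_of_superset (Icc_mem_nhdsGE ht.2) (Set.Icc_subset_Icc_left ht.1)

/-- Solutions on bounded intervals of an ODE with Lipschitz right-hand side vanishing at `0`. -/
lemma exists_solution_Icc {d : ℕ} {g : (Fin d → ℝ) → (Fin d → ℝ)} {L : NNReal}
    (hg : LipschitzWith L g) (hg0 : g 0 = 0) (x₀ : Fin d → ℝ) {T : ℝ} (hT : 0 ≤ T) :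
    ∃ y : ℝ → Fin d → ℝ, y 0 = x₀ ∧
      ∀ t ∈ Set.Icc 0 T, HasDerivWithinAt y (g (y t)) (Set.Icc 0 T) t := by
  -- `R` is the a priori Grönwall bound. The clamped field is bounded by `L * R`, so Picard–Lindelöf
  -- covers all of `[0, T]`, and the bound then shows that the clamp is never active.
  set R : ℝ := ‖x₀‖ * Real.exp (L * T) with hRdef
  have hR : 0 ≤ R := by positivity
  have hPL : IsPicardLindelof (fun _ : ℝ => fun x => g (clamp R x))
      (⟨0, by simpa using hT⟩ : Set.Icc (0 : ℝ) T) x₀ (L * R.toNNReal * T.toNNReal) 0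
      (L * R.toNNReal) (L * 1) := by
    refine ⟨fun t _ => ((hg.comp (lipschitzWith_clamp R))).lipschitzOnWith,
      fun x _ => continuousOn_const, fun t _ x _ => ?_, ?_⟩
    · refine (norm_le_of_lipschitz hg hg0 _).trans ?_
      rw [NNReal.coe_mul, Real.coe_toNNReal _ hR]
      gcongr
      exact norm_clamp_le hR x
    · simp [hT, hR]
  obtain ⟨y, hy0, hy⟩ := hPL.exists_eq_forall_mem_Icc_hasDerivWithinAt₀
  have hcont : ContinuousOn y (Set.Icc 0 T) := fun t ht => (hy t ht).continuousWithinAt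
  have hbound : ∀ t ∈ Set.Icc 0 T, ‖y t‖ ≤ R := by
    intro t ht
    have := norm_le_gronwallBound_of_norm_deriv_right_le (δ := ‖x₀‖) (K := L) (ε := 0) hcont
      (fun t ht => hasDerivWithinAt_Ici_of_Icc ht (hy t (Set.Ico_subset_Icc_self ht)))
      (by rw [← hy0]) (fun s _ => ?_) t ht
    · rw [gronwallBound_ε0, sub_zero] at this
      refine this.trans ?_
      rw [hRdef]
      gcongr
      exact ht.2
    · rw [add_zero]
      refine (norm_le_of_lipschitz hg hg0 _).trans ?_
      gcongr
      exact norm_clamp_le_norm hR _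
  refine ⟨y, hy0, fun t ht => ?_⟩
  have := hy t ht
  rwa [clamp_eq_self (hbound t ht)] at this

lemma exists_isSolution {d : ℕ} {g : (Fin d → ℝ) → (Fin d → ℝ)} {L : NNReal}
    (hg : LipschitzWith L g) (hg0 : g 0 = 0) (x₀ : Fin d → ℝ) :
    ∃ z : ℝ → Fin d → ℝ, z 0 = x₀ ∧ IsSolution g z := by
  choose y hy0 hy using fun n : ℕ => exists_solution_Icc hg hg0 x₀ (Nat.cast_nonneg (α := ℝ) n)
  have heq : ∀ m n : ℕ, m ≤ n → Set.EqOn (y m) (y n) (Set.Icc 0 m) := by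
    intro m n hmn
    have hsub : Set.Icc (0 : ℝ) m ⊆ Set.Icc 0 n := Set.Icc_subset_Icc_right (by exact_mod_cast hmn)
    refine ODE_solution_unique (v := fun _ => g) (fun _ => hg)
      (fun t ht => (hy m t ht).continuousWithinAt)
      (fun t ht => hasDerivWithinAt_Ici_of_Icc ht (hy m t (Set.Ico_subset_Icc_self ht)))
      (fun t ht => (hy n t (hsub ht)).continuousWithinAt.mono hsub)
      (fun t ht => hasDerivWithinAt_Ici_of_Icc ht
        ((hy n t (hsub (Set.Ico_subset_Icc_self ht))).mono hsub)) ?_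
    rw [hy0, hy0]
  refine ⟨fun t => y (⌊t⌋₊ + 2) t, hy0 _, fun t ht => ?_⟩
  -- The `+ 2` makes `[0, N]` contain all nonnegative times below `t + 1`, so near `t` the glued
  -- function agrees with the single solution `y N`.
  set N := ⌊t⌋₊ + 2 with hN
  have htN : t + 1 < N := by
    have := Nat.lt_floor_add_one t
    push_cast [hN]
    linarith
  have hd := hy N t ⟨ht, by linarith⟩
  have hmem : Set.Icc (0 : ℝ) N ∈ 𝓝[Set.Ici 0] t := by
    rw [← Set.Ici_inter_Iic]
    exact inter_mem_nhdsWithin _ (Iic_mem_nhds (by linarith))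
  refine (hd.mono_of_mem_nhdsWithin hmem).congr_of_eventuallyEq ?_ rfl
  have hlt : Set.Iio (t + 1) ∈ 𝓝[Set.Ici 0] t := mem_nhdsWithin_of_mem_nhds (Iio_mem_nhds (by linarith))
  filter_upwards [hlt, self_mem_nhdsWithin] with s hs hs0
  have hs1 : s < ⌊s⌋₊ + 1 := Nat.lt_floor_add_one s
  rcases le_total (⌊s⌋₊ + 2) N with h | h
  · exact heq _ _ h ⟨hs0, by push_cast; linarith⟩
  · exact (heq _ _ h ⟨hs0, by have : s < t + 1 := hs; linarith⟩).symm

namespace IsSolution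

variable {d : ℕ} {g : (Fin d → ℝ) → (Fin d → ℝ)} {z w : ℝ → Fin d → ℝ} {L : NNReal}

lemma continuousOn (hz : IsSolution g z) : ContinuousOn z (Set.Ici 0) :=
  fun t ht => (hz t ht).continuousWithinAt

lemma hasDerivWithinAt_right (hz : IsSolution g z) {t : ℝ} (ht : 0 ≤ t) :
    HasDerivWithinAt z (g (z t)) (Set.Ici t) t :=
  (hz t ht).mono (Set.Ici_subset_Ici.2 ht)

lemma shift (hz : IsSolution g z) {a : ℝ} (ha : 0 ≤ a) : IsSolution g fun t => z (a + t) := by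
  intro t ht
  have h1 := hz (a + t) (by positivity)
  have h2 : HasDerivWithinAt (fun s : ℝ => a + s) 1 (Set.Ici 0) t :=
    ((hasDerivAt_id t).const_add a).hasDerivWithinAt
  have h3 := h1.scomp t h2 (fun s hs => add_nonneg ha hs)
  rwa [one_smul] at h3

lemma dist_le (hg : LipschitzWith L g) (hz : IsSolution g z) (hw : IsSolution g w) {t : ℝ}
    (ht : 0 ≤ t) : dist (z t) (w t) ≤ dist (z 0) (w 0) * Real.exp (L * t) := by
  simpa using dist_le_of_trajectories_ODE (v := fun _ => g) (a := 0) (b := t) (fun _ => hg)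
    (hz.continuousOn.mono Set.Icc_subset_Ici_self)
    (fun s hs => hz.hasDerivWithinAt_right hs.1)
    (hw.continuousOn.mono Set.Icc_subset_Ici_self)
    (fun s hs => hw.hasDerivWithinAt_right hs.1) le_rfl t ⟨ht, le_rfl⟩

lemma norm_le (hg : LipschitzWith L g) (hg0 : g 0 = 0) (hz : IsSolution g z) {t : ℝ}
    (ht : 0 ≤ t) : ‖z t‖ ≤ ‖z 0‖ * Real.exp (L * t) := by
  have h0 : IsSolution g fun _ => 0 := fun s _ => by
    simpa [hg0] using hasDerivWithinAt_const s (Set.Ici (0 : ℝ)) (0 : Fin d → ℝ)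
  simpa using hz.dist_le hg h0 ht

lemma norm_sub_le (hg : LipschitzWith L g) (hg0 : g 0 = 0) (hz : IsSolution g z) {B s t : ℝ}
    (hs : 0 ≤ s) (hst : s ≤ t) (hB : ∀ τ ∈ Set.Icc s t, ‖z τ‖ ≤ B) :
    ‖z t - z s‖ ≤ L * B * (t - s) := by
  refine norm_image_sub_le_of_norm_deriv_right_le_segment (a := s) (b := t)
    (hz.continuousOn.mono fun τ hτ => hs.trans hτ.1)
    (fun τ hτ => hz.hasDerivWithinAt_right (hs.trans hτ.1)) (fun τ hτ => ?_) t ⟨hst, le_rfl⟩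
  refine (norm_le_of_lipschitz hg hg0 _).trans ?_
  gcongr
  exact hB τ (Set.Ico_subset_Icc_self hτ)

/-- One-step error of the Euler scheme. -/
lemma norm_euler_le (hg : LipschitzWith L g) (hg0 : g 0 = 0) (hz : IsSolution g z) {B s t : ℝ}
    (hs : 0 ≤ s) (hst : s ≤ t) (hB : ∀ τ ∈ Set.Icc s t, ‖z τ‖ ≤ B) :
    ‖z t - z s - (t - s) • g (z s)‖ ≤ L ^ 2 * B * (t - s) ^ 2 := by
  have hB0 : 0 ≤ B := (norm_nonneg _).trans (hB s ⟨le_rfl, hst⟩)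
  -- Mean value inequality for `τ ↦ z τ - τ • g (z s)`, whose derivative is controlled by the
  -- displacement of `z` since `s`.
  have key := norm_image_sub_le_of_norm_deriv_right_le_segment (a := s) (b := t)
    (f := fun τ => z τ - τ • g (z s)) (f' := fun τ => g (z τ) - g (z s))
    (C := L ^ 2 * B * (t - s))
    ((hz.continuousOn.mono fun τ hτ => hs.trans hτ.1).sub
      (continuous_id.smul continuous_const).continuousOn)
    (fun τ hτ => by
      have h := (hz.hasDerivWithinAt_right (hs.trans hτ.1)).sub
        ((hasDerivAt_id τ).smul_const (g (z s))).hasDerivWithinAt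
      rwa [one_smul] at h)
    (fun τ hτ => ?_) t ⟨hst, le_rfl⟩
  · calc _ = ‖z t - t • g (z s) - (z s - s • g (z s))‖ := by congr 1; module
      _ ≤ _ := key
      _ = _ := by ring
  · calc ‖g (z τ) - g (z s)‖ ≤ L * ‖z τ - z s‖ := by
          simpa [dist_eq_norm] using hg.dist_le_mul (z τ) (z s)
      _ ≤ L * (L * B * (τ - s)) := by
          gcongr
          exact hz.norm_sub_le hg hg0 hs hτ.1 fun r hr => hB r ⟨hr.1, hr.2.trans hτ.2.le⟩
      _ ≤ L * (L * B * (t - s)) := by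
          gcongr
          exact hτ.2.le
      _ = _ := by ring

end IsSolution

/-! ### Uniform attraction and the scaling limit. -/

/-- A globally asymptotically stable origin attracts the unit ball uniformly. -/
lemma IsGASEquilibrium.exists_uniform_time {d : ℕ} {g : (Fin d → ℝ) → (Fin d → ℝ)} {L : NNReal}
    (hg : LipschitzWith L g) (hgas : IsGASEquilibrium g 0) {ε : ℝ} (hε : 0 < ε) :
    ∃ T : ℝ, 0 < T ∧ ∀ z, IsSolution g z → ‖z 0‖ ≤ 1 → ∀ t, T ≤ t → ‖z t‖ < ε := by
  obtain ⟨η, hη, hstab⟩ := hgas.stable ε hε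
  have hg0 := hgas.equilibrium
  -- Attractivity brings the solution from `x₀` within `η / 2` of `0` at some time, continuous
  -- dependence extends this to nearby starts, and Lyapunov stability keeps them small forever.
  -- Compactness of the ball then leaves finitely many times.
  have key : ∀ x₀ : Fin d → ℝ, ∃ T : ℝ, 0 ≤ T ∧ ∃ U ∈ 𝓝 x₀, ∀ z, IsSolution g z → z 0 ∈ U →
      ∀ t, T ≤ t → ‖z t‖ < ε := by
    intro x₀
    obtain ⟨w, hw0, hw⟩ := exists_isSolution hg hg0 x₀
    have hev := (hgas.attractive w hw).eventually (Metric.ball_mem_nhds 0 (half_pos hη))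
    obtain ⟨T, hT, hT0⟩ := (hev.and (eventually_ge_atTop 0)).exists
    refine ⟨T, hT0, Metric.ball x₀ (η / 2 * Real.exp (-(L * T))),
      Metric.ball_mem_nhds _ (by positivity), fun z hz hz0 t ht => ?_⟩
    have h1 : dist (z T) (w T) < η / 2 := by
      refine (hz.dist_le hg hw hT0).trans_lt ?_
      rw [hw0]
      calc _ < η / 2 * Real.exp (-(L * T)) * Real.exp (L * T) := by
            gcongr
            exact hz0
        _ = η / 2 := by rw [mul_assoc, ← Real.exp_add]; simp
    have h2 : ‖z T‖ < η := by
      have h3 : dist (w T) 0 < η / 2 := hT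
      rw [← dist_zero_right]
      linarith [dist_triangle (z T) (w T) 0]
    have := hstab _ (hz.shift hT0) (by simpa using h2) (t - T) (by linarith)
    simpa using this
  choose T hT0 U hU hTU using key
  obtain ⟨s, -, hs⟩ := (isCompact_closedBall (0 : Fin d → ℝ) 1).elim_nhds_subcover U fun x _ => hU x
  refine ⟨1 + ∑ x ∈ s, T x, by have := Finset.sum_nonneg fun x (_ : x ∈ s) => hT0 x; linarith,
    fun z hz hz0 t ht => ?_⟩
  obtain ⟨x, hx, hxU⟩ := Set.mem_iUnion₂.1 (hs (show z 0 ∈ Metric.closedBall 0 1 by simpa using hz0))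
  refine hTU x z hz hxU t ?_
  have := Finset.single_le_sum (fun x _ => hT0 x) hx
  linarith

/-- Every rescaling of `h` has the same Lipschitz constant as `h`, and pointwise limits preserve it.
-/
lemma DriftCondition.lipschitzWith_hInf {d : ℕ} {h hInf : (Fin d → ℝ) → (Fin d → ℝ)} {L : NNReal}
    (hL : LipschitzWith L h) (hD : DriftCondition h hInf) : LipschitzWith L hInf := by
  refine LipschitzWith.of_dist_le_mul fun x y => ?_
  have hlim : ∀ x, Tendsto (fun c : ℝ => c⁻¹ • h (c • x)) atTop (𝓝 (hInf x)) := fun x =>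
    (hD.scaling_limit {x} isCompact_singleton).tendsto_at rfl
  refine le_of_tendsto ((hlim x).dist (hlim y)) ?_
  filter_upwards [eventually_gt_atTop 0] with c hc
  rw [dist_smul₀, Real.norm_of_nonneg (by positivity)]
  calc c⁻¹ * dist (h (c • x)) (h (c • y)) ≤ c⁻¹ * (L * dist (c • x) (c • y)) := by
        gcongr
        exact hL.dist_le_mul _ _
    _ = L * dist x y := by
        rw [dist_smul₀, Real.norm_of_nonneg hc.le]
        field_simp

/-! ### Tracking an ODE by a perturbed asynchronous Euler scheme. -/

/-- Summed form of the discrete Grönwall inequality. -/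
lemma le_mul_exp_of_le_add_sum {e c : ℕ → ℝ} {E : ℝ} {n : ℕ} (hc : ∀ k < n, 0 ≤ c k)
    (hE : 0 ≤ E) (h : ∀ k ≤ n, e k ≤ E + ∑ j ∈ Finset.range k, c j * e j) :
    ∀ k ≤ n, e k ≤ E * Real.exp (∑ j ∈ Finset.range k, c j) := by
  -- The induction bounds the right-hand side of `h`, since this quantity obeys a one-step recursion
  -- while `e` itself need not.
  have key : ∀ k ≤ n, E + ∑ j ∈ Finset.range k, c j * e j
      ≤ E * Real.exp (∑ j ∈ Finset.range k, c j) := by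
    intro k
    induction k with
    | zero => simp
    | succ k ih =>
      intro hk
      have ihk := ih (by omega)
      have hck := hc k (by omega)
      rw [Finset.sum_range_succ, Finset.sum_range_succ, Real.exp_add, ← mul_assoc]
      calc _ ≤ (E * Real.exp (∑ j ∈ Finset.range k, c j)) * (c k + 1) := by
            have := mul_le_mul_of_nonneg_left ((h k (by omega)).trans ihk) hck
            linarith
        _ ≤ _ := by
            gcongr
            exact Real.add_one_le_exp _
  exact fun k hk => (h k hk).trans (key k hk)

lemma abel_summation {R : Type*} [CommRing R] (f v : ℕ → R) (k : ℕ) :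
    ∑ j ∈ Finset.range k, f j * v j = (∑ j ∈ Finset.range k, f j) * v k -
      ∑ j ∈ Finset.range k, (∑ l ∈ Finset.range (j + 1), f l) * (v (j + 1) - v j) := by
  induction k with
  | zero => simp
  | succ k ih =>
    rw [Finset.sum_range_succ, ih, Finset.sum_range_succ f k,
      Finset.sum_range_succ (fun j => (∑ l ∈ Finset.range (j + 1), f l) * (v (j + 1) - v j)) k,
      Finset.sum_range_succ f k]
    ring

/-- A perturbed, asynchronous Euler scheme stays close to the solution of the ODE. -/
lemma IsSolution.norm_sub_le_of_perturbed_euler {d : ℕ} {g : (Fin d → ℝ) → (Fin d → ℝ)}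
    {L : NNReal} {z : ℝ → Fin d → ℝ} (hg : LipschitzWith L g) (hg0 : g 0 = 0)
    (hz : IsSolution g z) {u b G ξ ζ : ℕ → Fin d → ℝ} {σ c : ℕ → ℝ} {n : ℕ} {B S η : ℝ}
    (hη : 0 ≤ η) (hS : 0 ≤ S) (hz0 : z 0 = u 0)
    (hu : ∀ k < n, u (k + 1) = u k + b k * G k + ξ k + ζ k)
    (hb : ∀ k < n, ∀ i, 0 ≤ b k i ∧ b k i ≤ c k)
    (hσ : ∀ k < n, 0 ≤ σ k ∧ σ k ≤ c k)
    (hc : ∑ k ∈ Finset.range n, c k ≤ S)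
    (hB : ∀ t ∈ Set.Icc 0 S, ‖z t‖ ≤ B)
    (hG : ∀ k < n, ‖G k - g (u k)‖ ≤ η)
    (hζ : ∀ k < n, ‖ζ k‖ ≤ c k * η)
    (hξ : ∀ k ≤ n, ‖∑ j ∈ Finset.range k, ξ j‖ ≤ η)
    (hbσ : ∀ k ≤ n, ‖∑ j ∈ Finset.range k, (b j - fun _ => σ j)‖ ≤ η)
    (hση : ∀ k < n, σ k ≤ η) :
    ∀ k ≤ n, ‖u k - z (∑ j ∈ Finset.range k, σ j)‖
      ≤ η * (1 + 2 * S + L * B + 2 * (L ^ 2 * B * S)) * Real.exp (L * S) := by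
  set s : ℕ → ℝ := fun k => ∑ j ∈ Finset.range k, σ j with hs
  set v : ℕ → Fin d → ℝ := fun k => g (z (s k)) with hv
  have hB0 : 0 ≤ B := (norm_nonneg _).trans (hB 0 ⟨le_rfl, hS⟩)
  have hs_succ : ∀ k, s (k + 1) = s k + σ k := fun k => Finset.sum_range_succ _ _
  have hcn : ∀ k < n, 0 ≤ c k := fun k hk => (hσ k hk).1.trans (hσ k hk).2
  have hcS : ∀ k ≤ n, ∑ j ∈ Finset.range k, c j ≤ S := fun k hk =>
    (Finset.sum_le_sum_of_subset_of_nonneg (Finset.range_mono hk)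
      fun j hj _ => hcn j (Finset.mem_range.1 hj)).trans hc
  have hs0 : ∀ k ≤ n, 0 ≤ s k := fun k hk =>
    Finset.sum_nonneg fun j hj => (hσ j (by have := Finset.mem_range.1 hj; omega)).1
  have hsS : ∀ k ≤ n, s k ≤ S := fun k hk =>
    (Finset.sum_le_sum fun j hj => (hσ j (by have := Finset.mem_range.1 hj; omega)).2).trans
      (hcS k hk)
  have hzB : ∀ k < n, ∀ τ ∈ Set.Icc (s k) (s (k + 1)), ‖z τ‖ ≤ B := fun k hk τ hτ =>
    hB τ ⟨(hs0 k hk.le).trans hτ.1, hτ.2.trans (hsS _ hk)⟩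
  have hsle : ∀ k < n, s k ≤ s (k + 1) := fun k hk => by
    rw [hs_succ]; linarith [(hσ k hk).1]
  have hvB : ∀ k ≤ n, ‖v k‖ ≤ L * B := fun k hk =>
    (norm_le_of_lipschitz hg hg0 _).trans (by gcongr; exact hB _ ⟨hs0 k hk, hsS k hk⟩)
  have hvd : ∀ k < n, ‖v (k + 1) - v k‖ ≤ L ^ 2 * B * σ k := fun k hk => by
    have h1 := hz.norm_sub_le hg hg0 (hs0 k hk.le) (hsle k hk) (hzB k hk)
    rw [hs_succ, add_sub_cancel_left] at h1
    calc ‖v (k + 1) - v k‖ ≤ L * ‖z (s k + σ k) - z (s k)‖ := by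
          simpa [hv, dist_eq_norm, hs_succ] using hg.dist_le_mul (z (s (k + 1))) (z (s k))
      _ ≤ L * (L * B * σ k) := by gcongr
      _ = _ := by ring
  -- The error splits into drift mismatch, clock mismatch, noise, bias and Euler discretization.
  -- Only the first involves the error itself, and Grönwall absorbs it.
  have hdecomp : ∀ k ≤ n, u k - z (s k) = ∑ j ∈ Finset.range k, b j * (G j - v j)
      + ∑ j ∈ Finset.range k, (b j - fun _ => σ j) * v j + ∑ j ∈ Finset.range k, ξ j
      + ∑ j ∈ Finset.range k, ζ j
      - ∑ j ∈ Finset.range k, (z (s (j + 1)) - z (s j) - (s (j + 1) - s j) • g (z (s j))) := by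
    intro k
    induction k with
    | zero => intro _; simp [hs, hz0]
    | succ k ih =>
      intro hk
      have ihk := ih (by omega)
      simp only [Finset.sum_range_succ _ k]
      have : u (k + 1) - z (s (k + 1)) = (u k - z (s k)) + b k * G k + ξ k + ζ k
          - (z (s (k + 1)) - z (s k)) := by
        rw [hu k (by omega)]; abel
      rw [this, ihk]
      funext i
      simp only [Pi.add_apply, Pi.sub_apply, Pi.mul_apply, Pi.smul_apply, smul_eq_mul,
        hs_succ, hv]
      ring
  refine fun k hk => (le_mul_exp_of_le_add_sum (c := fun j => L * c j)
    (E := η * (1 + 2 * S + L * B + 2 * (L ^ 2 * B * S)))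
    (e := fun k => ‖u k - z (s k)‖) (n := n)
    (fun k hk => mul_nonneg L.2 (hcn k hk)) (by positivity) ?_ k hk).trans ?_
  swap
  · gcongr
    rw [← Finset.mul_sum]
    exact mul_le_mul_of_nonneg_left (hcS k hk) L.2
  intro k hk
  have hlt : ∀ j ∈ Finset.range k, j < n := fun j hj => by have := Finset.mem_range.1 hj; omega
  have h1 : ‖∑ j ∈ Finset.range k, b j * (G j - v j)‖
      ≤ η * S + ∑ j ∈ Finset.range k, L * c j * ‖u j - z (s j)‖ := by
    calc _ ≤ ∑ j ∈ Finset.range k, (η * c j + L * c j * ‖u j - z (s j)‖) := by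
          refine norm_sum_le_of_le _ fun j hj => ?_
          have hj' := hlt j hj
          have hbn : ‖b j‖ ≤ c j := (pi_norm_le_iff_of_nonneg (hcn j hj')).2 fun i => by
            rw [Real.norm_of_nonneg (hb j hj' i).1]; exact (hb j hj' i).2
          have hGv : ‖G j - v j‖ ≤ η + L * ‖u j - z (s j)‖ := by
            calc _ = ‖(G j - g (u j)) + (g (u j) - v j)‖ := by congr 1; abel
              _ ≤ ‖G j - g (u j)‖ + ‖g (u j) - v j‖ := norm_add_le _ _
              _ ≤ _ := add_le_add (hG j hj') (by
                  simpa [dist_eq_norm] using hg.dist_le_mul (u j) (z (s j)))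
          calc _ ≤ ‖b j‖ * ‖G j - v j‖ := norm_mul_le _ _
            _ ≤ c j * (η + L * ‖u j - z (s j)‖) := by
                gcongr
                exact hcn j hj'
            _ = _ := by ring
      _ ≤ _ := by
          rw [Finset.sum_add_distrib, ← Finset.mul_sum]
          gcongr
          exact hcS k hk
  -- Clock mismatches are small only in cumulative sum, not in absolute sum. Summation by parts
  -- moves the differences onto `v`, whose total variation is at most `L ^ 2 * B * S`.
  have h2 : ‖∑ j ∈ Finset.range k, (b j - fun _ => σ j) * v j‖
      ≤ η * (L * B) + η * (L ^ 2 * B * S) := by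
    rw [abel_summation]
    refine (_root_.norm_sub_le _ _).trans (add_le_add ?_ ?_)
    · exact (norm_mul_le _ _).trans
        (mul_le_mul (hbσ k hk) (hvB k hk) (norm_nonneg _) hη)
    · calc _ ≤ ∑ j ∈ Finset.range k, η * (L ^ 2 * B * σ j) := by
            refine norm_sum_le_of_le _ fun j hj => (norm_mul_le _ _).trans ?_
            exact mul_le_mul (hbσ _ (hlt j hj)) (hvd j (hlt j hj)) (norm_nonneg _) hη
        _ = η * (L ^ 2 * B * s k) := by rw [hs]; simp only [Finset.mul_sum]
        _ ≤ _ := by gcongr; exact hsS k hk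
  have h4 : ‖∑ j ∈ Finset.range k, ζ j‖ ≤ η * S := by
    calc _ ≤ ∑ j ∈ Finset.range k, c j * η := norm_sum_le_of_le _ fun j hj => hζ j (hlt j hj)
      _ = η * ∑ j ∈ Finset.range k, c j := by rw [← Finset.sum_mul, mul_comm]
      _ ≤ _ := by gcongr; exact hcS k hk
  have h5 : ‖∑ j ∈ Finset.range k,
      (z (s (j + 1)) - z (s j) - (s (j + 1) - s j) • g (z (s j)))‖ ≤ η * (L ^ 2 * B * S) := by
    calc _ ≤ ∑ j ∈ Finset.range k, η * (L ^ 2 * B * σ j) := by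
          refine norm_sum_le_of_le _ fun j hj => ?_
          have hj' := hlt j hj
          refine (hz.norm_euler_le hg hg0 (hs0 j hj'.le) (hsle j hj') (hzB j hj')).trans ?_
          have h0 := (hσ j hj').1
          calc _ = L ^ 2 * B * σ j * σ j := by rw [hs_succ]; ring
            _ ≤ L ^ 2 * B * σ j * η := by gcongr; exact hση j hj'
            _ = _ := by ring
      _ = η * (L ^ 2 * B * s k) := by rw [hs]; simp only [Finset.mul_sum]
      _ ≤ _ := by gcongr; exact hsS k hk
  have h3 := hξ k hk
  rw [hdecomp k hk]
  refine (_root_.norm_sub_le _ _).trans ?_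
  refine (add_le_add ((norm_add_le _ _).trans (add_le_add ((norm_add_le _ _).trans
    (add_le_add ((norm_add_le _ _).trans (add_le_add h1 h2)) h3)) h4)) h5).trans ?_
  linarith

/-! ### Local clocks, windows and stepsizes. -/

/-- The effective stepsize of component `i` at iteration `n`. -/
def updateStep {Ω : Type*} {d : ℕ} (α : ℕ → ℝ) (Y : ℕ → Ω → Finset (Fin d)) (n : ℕ) (i : Fin d)
    (ω : Ω) : ℝ :=
  if i ∈ Y n ω then α (updateCount Y n i ω) else 0

section Counting

variable {Ω : Type*} {d : ℕ} {α : ℕ → ℝ} {Y : ℕ → Ω → Finset (Fin d)} {ω : Ω} {i j : Fin d}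

lemma updateCount_succ (n : ℕ) (i : Fin d) (ω : Ω) :
    updateCount Y (n + 1) i ω = updateCount Y n i ω + if i ∈ Y n ω then 1 else 0 :=
  Finset.sum_range_succ _ _

lemma updateCount_mono : Monotone fun n => updateCount Y n i ω :=
  monotone_nat_of_le_succ fun n => by rw [updateCount_succ]; exact Nat.le_add_right _ _

lemma updateCount_le (n : ℕ) : updateCount Y n i ω ≤ n := by
  refine ((Finset.sum_le_sum fun k _ => ?_).trans_eq
    (Finset.sum_const_nat (m := 1) fun _ _ => rfl)).trans ?_
  · split_ifs <;> simp
  · simp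

/-- Successive updates of component `i` use `f 0, f 1, ...` in order, once each. With `f = α` this
gives the local clock, with `f = α ^ 2` the summability of squared effective steps. -/
lemma sum_updateCount (f : ℕ → ℝ) (n : ℕ) :
    ∑ m ∈ Finset.range n, (if i ∈ Y m ω then f (updateCount Y m i ω) else 0) =
      ∑ k ∈ Finset.range (updateCount Y n i ω), f k := by
  induction n with
  | zero => simp [updateCount]
  | succ n ih =>
    rw [Finset.sum_range_succ, ih, updateCount_succ]
    split_ifs
    · rw [Finset.sum_range_succ]
    · simp

lemma sum_Ico_updateStep {m n : ℕ} (hmn : m ≤ n) :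
    ∑ k ∈ Finset.Ico m n, updateStep α Y k i ω =
      ∑ k ∈ Finset.range (updateCount Y n i ω), α k -
        ∑ k ∈ Finset.range (updateCount Y m i ω), α k := by
  rw [Finset.sum_Ico_eq_sub _ hmn]
  simp only [updateStep, sum_updateCount]

lemma sum_Icc_eq_sub (f : ℕ → ℝ) {m n : ℕ} (hmn : m ≤ n + 1) :
    ∑ k ∈ Finset.Icc m n, f k = ∑ k ∈ Finset.range (n + 1), f k - ∑ k ∈ Finset.range m, f k := by
  rw [← Finset.sum_Ico_eq_sub _ hmn]
  congr 1

lemma updateStep_nonneg (hα : ∀ n, 0 < α n) (n : ℕ) : 0 ≤ updateStep α Y n i ω := by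
  unfold updateStep
  split_ifs
  exacts [(hα _).le, le_rfl]

end Counting

section Window

variable {α : ℕ → ℝ} {n m : ℕ} {x : ℝ}

lemma window_spec (hα : Tendsto (fun n => ∑ k ∈ Finset.range n, α k) atTop atTop) (n : ℕ) (x : ℝ) :
    n < window α n x ∧ x ≤ ∑ k ∈ Finset.Icc n (window α n x), α k := by
  refine Nat.sInf_mem (s := {m : ℕ | n < m ∧ x ≤ ∑ k ∈ Finset.Icc n m, α k}) ?_
  have h1 := (tendsto_add_atTop_iff_nat 1).2 hα
  obtain ⟨m, hm, hm'⟩ := ((h1.eventually_ge_atTop (x + ∑ k ∈ Finset.range n, α k)).and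
    (eventually_gt_atTop n)).exists
  refine ⟨m, hm', ?_⟩
  rw [sum_Icc_eq_sub _ (by omega)]
  linarith

lemma sum_lt_of_lt_window (h1 : n < m) (h2 : m < window α n x) :
    ∑ k ∈ Finset.Icc n m, α k < x := by
  by_contra h
  exact Nat.notMem_of_lt_sInf h2 ⟨h1, not_lt.1 h⟩

lemma tendsto_window (hα : Tendsto (fun n => ∑ k ∈ Finset.range n, α k) atTop atTop) (x : ℝ) :
    Tendsto (fun n => window α n x) atTop atTop :=
  tendsto_atTop_mono (fun n => (window_spec hα n x).1.le) tendsto_id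

end Window

namespace StepsizeCondition

variable {α : ℕ → ℝ}

lemma tendsto_zero (hα : StepsizeCondition α) : Tendsto α atTop (𝓝 0) := by
  have h := (hα.summable_sq.tendsto_atTop_zero).sqrt
  simpa [Real.sqrt_sq (hα.pos _).le] using h

lemma exists_antitone (hα : StepsizeCondition α) :
    ∃ N, ∀ m n, N ≤ m → m ≤ n → α n ≤ α m := by
  obtain ⟨N, hN⟩ := eventually_atTop.1 hα.eventually_noninc
  refine ⟨N, fun m n hm hmn => ?_⟩
  induction n, hmn using Nat.le_induction with
  | base => exact le_rfl
  | succ k hk ih => exact (hN k (hm.trans hk)).trans ih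

end StepsizeCondition

/-! ### Local clocks advance equally over bounded time intervals. -/

section Asynchrony

variable {Ω : Type*} {d : ℕ} {α : ℕ → ℝ} {Y : ℕ → Ω → Finset (Fin d)} {ω : Ω} {ρ C : ℝ}

lemma exists_linear_lower_bound {Δ : ℝ} (hΔ : 0 < Δ)
    (h : ∀ i : Fin d, Δ ≤ liminf (fun n : ℕ => (updateCount Y n i ω : ℝ) / n) atTop) :
    ∃ ρ : ℝ, 0 < ρ ∧ ρ < 1 ∧ ∀ᶠ n : ℕ in atTop, ∀ i : Fin d, ρ * n ≤ updateCount Y n i ω := by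
  refine ⟨min (Δ / 2) (1 / 2), by positivity, (min_le_right _ _).trans_lt (by norm_num), ?_⟩
  rw [eventually_all]
  intro i
  have hlt : min (Δ / 2) (1 / 2) < liminf (fun n : ℕ => (updateCount Y n i ω : ℝ) / n) atTop :=
    (min_le_left _ _).trans_lt ((half_lt_self hΔ).trans_le (h i))
  have hb : IsBoundedUnder (· ≥ ·) atTop (fun n : ℕ => (updateCount Y n i ω : ℝ) / n) :=
    isBoundedUnder_of ⟨0, fun n => by positivity⟩
  filter_upwards [eventually_lt_of_lt_liminf hlt hb, eventually_gt_atTop 0] with n hn hn0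
  exact ((lt_div_iff₀ (by exact_mod_cast hn0)).1 hn).le

lemma tendsto_updateCount (hρ : 0 < ρ)
    (hν : ∀ᶠ n : ℕ in atTop, ∀ i : Fin d, ρ * n ≤ updateCount Y n i ω) (i : Fin d) :
    Tendsto (fun n => updateCount Y n i ω) atTop atTop := by
  refine tendsto_natCast_atTop_iff (R := ℝ).1 ?_
  exact tendsto_atTop_mono' _ (hν.mono fun n h => h i)
    (tendsto_natCast_atTop_atTop.const_mul_atTop hρ)

/-- The count lies between `ρ * n` and `n`, and `α` is eventually nonincreasing. The lower end and
`ratio_bounded` give the upper bound; the upper end, for some updated component, gives the lower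
bound. -/
lemma exists_updateStep_bounds (hα : StepsizeCondition α) (hY : ∀ n, (Y n ω).Nonempty)
    (hρ : 0 < ρ) (hρ1 : ρ < 1)
    (hν : ∀ᶠ n : ℕ in atTop, ∀ i : Fin d, ρ * n ≤ updateCount Y n i ω) :
    ∃ C : ℝ, 0 < C ∧ ∀ᶠ n in atTop, (∀ i, updateStep α Y n i ω ≤ C * α n) ∧
      α n ≤ ∑ i, updateStep α Y n i ω := by
  obtain ⟨C, hC⟩ := hα.ratio_bounded ρ hρ hρ1
  obtain ⟨N, hN⟩ := hα.exists_antitone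
  have hfl : Tendsto (fun n : ℕ => ⌊ρ * n⌋₊) atTop atTop :=
    tendsto_nat_floor_atTop.comp (tendsto_natCast_atTop_atTop.const_mul_atTop hρ)
  refine ⟨max C 1, by positivity, ?_⟩
  filter_upwards [hν, hfl.eventually_ge_atTop N] with n hn hnN
  have hfloor : ∀ i, ⌊ρ * n⌋₊ ≤ updateCount Y n i ω := fun i => Nat.floor_le_of_le (hn i)
  constructor
  · intro i
    unfold updateStep
    split_ifs
    · have h1 : α (updateCount Y n i ω) ≤ α ⌊ρ * n⌋₊ := hN _ _ hnN (hfloor i)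
      have h2 : α ⌊ρ * n⌋₊ / α n ≤ C := hC ⟨n, rfl⟩
      rw [div_le_iff₀ (hα.pos n)] at h2
      refine h1.trans (h2.trans ?_)
      gcongr
      exacts [(hα.pos n).le, le_max_left _ _]
    · have := hα.pos n
      positivity
  · obtain ⟨i, hi⟩ := hY n
    refine le_trans ?_ (Finset.single_le_sum (fun j _ => updateStep_nonneg hα.pos n)
      (Finset.mem_univ i))
    rw [updateStep, if_pos hi]
    exact hN _ _ (hnN.trans (hfloor i)) (updateCount_le n)

/-- The local clocks are asymptotically equivalent to the global clock. -/
lemma tendsto_clock_ratio (hα : StepsizeCondition α) (hρ : 0 < ρ) (hρ1 : ρ < 1)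
    (hν : ∀ᶠ n : ℕ in atTop, ∀ i : Fin d, ρ * n ≤ updateCount Y n i ω) (i : Fin d) :
    Tendsto (fun n => (∑ k ∈ Finset.range (updateCount Y n i ω), α k) /
      ∑ k ∈ Finset.range (n + 1), α k) atTop (𝓝 1) := by
  have hA := (tendsto_add_atTop_iff_nat 1).2 hα.sum_eq_top
  -- `partial_sums` is evaluated at the moving point `y = ν(n, i) / n` of `[ρ, 1]`, where uniformity
  -- is essential. It yields one extra term `α (ν(n, i))`, negligible by `h2`.
  have h1 : Tendsto (fun n => (∑ k ∈ Finset.range (updateCount Y n i ω + 1), α k) /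
      ∑ k ∈ Finset.range (n + 1), α k) atTop (𝓝 1) := by
    rw [Metric.tendsto_nhds]
    intro ε hε
    have := Metric.tendstoUniformlyOn_iff.1 (hα.partial_sums ρ hρ hρ1) ε hε
    filter_upwards [this, hν, eventually_gt_atTop 0] with n hn hνn hn0
    have hn0' : (0 : ℝ) < n := by exact_mod_cast hn0
    have := hn ((updateCount Y n i ω : ℝ) / n) ⟨(le_div_iff₀ hn0').2 (hνn i),
      (div_le_one hn0').2 (by exact_mod_cast updateCount_le (Y := Y) (ω := ω) (i := i) n)⟩
    rwa [div_mul_cancel₀ _ hn0'.ne', Nat.floor_natCast, dist_comm] at this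
  have h2 : Tendsto (fun n => α (updateCount Y n i ω) / ∑ k ∈ Finset.range (n + 1), α k)
      atTop (𝓝 0) :=
    (hα.tendsto_zero.comp (tendsto_updateCount hρ hν i)).div_atTop hA
  have h3 := h1.sub h2
  rw [sub_zero] at h3
  refine h3.congr fun n => ?_
  rw [← sub_div, Finset.sum_range_succ, add_sub_cancel_right]

lemma exists_max_of_tendsto_atBot {g : ℕ → ℝ} (hg : Tendsto g atTop atBot) (n₀ : ℕ) :
    ∃ n ≥ n₀, ∀ m ≥ n₀, g m ≤ g n := by
  obtain ⟨N, hN⟩ := eventually_atTop.1 (hg.eventually_le_atBot (g n₀))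
  obtain ⟨n, hn, hmax⟩ := (Finset.Icc n₀ (max N n₀)).exists_max_image g ⟨n₀, by simp⟩
  refine ⟨n, (Finset.mem_Icc.1 hn).1, fun m hm => ?_⟩
  rcases le_total m (max N n₀) with h | h
  · exact hmax m (Finset.mem_Icc.2 ⟨hm, h⟩)
  · exact (hN m ((le_max_left _ _).trans h)).trans (hmax n₀ (by simp))

/-- No component can be updated at a strictly faster asymptotic rate than another one. -/
lemma not_eventually_window_sum_ge (hα : StepsizeCondition α) (hρ : 0 < ρ) (hρ1 : ρ < 1)
    (hν : ∀ᶠ n : ℕ in atTop, ∀ i : Fin d, ρ * n ≤ updateCount Y n i ω) (i j : Fin d)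
    {x : ℝ} (hx : 0 < x) {c : ℝ} (hc : 1 < c) :
    ¬ ∀ᶠ n in atTop,
      c * ∑ k ∈ Finset.Icc (updateCount Y n j ω) (updateCount Y (window α n x) j ω), α k ≤
        ∑ k ∈ Finset.Icc (updateCount Y n i ω) (updateCount Y (window α n x) i ω), α k := by
  intro hev
  set A : ℕ → ℝ := fun n => ∑ k ∈ Finset.range (n + 1), α k with hAdef
  set a : Fin d → ℕ → ℝ := fun i n => ∑ k ∈ Finset.range (updateCount Y n i ω), α k with hadef
  have hA : Tendsto A atTop atTop := (tendsto_add_atTop_iff_nat 1).2 hα.sum_eq_top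
  -- With this `κ` the potential `a i - c * a j + κ * A` is asymptotic to `-κ * A`, hence tends to
  -- `-∞`, and so attains a maximum beyond any index.
  set κ : ℝ := (c - 1) / 2 with hκ
  have hκ0 : 0 < κ := by rw [hκ]; linarith
  have hg : Tendsto (fun n => a i n - c * a j n + κ * A n) atTop atBot := by
    have h1 : Tendsto (fun n => (a i n / A n - c * (a j n / A n) + κ) * A n) atTop atBot := by
      refine Tendsto.neg_mul_atTop (C := 1 - c * 1 + κ) (by rw [hκ]; linarith) ?_ hA
      exact ((tendsto_clock_ratio hα hρ hρ1 hν i).sub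
        ((tendsto_clock_ratio hα hρ hρ1 hν j).const_mul c)).add_const κ
    refine h1.congr' ?_
    filter_upwards [hA.eventually_gt_atTop 0] with n hn
    field_simp
  have hνN : Tendsto (fun n => α (updateCount Y (window α n x) i ω)) atTop (𝓝 0) :=
    (hα.tendsto_zero.comp (tendsto_updateCount hρ hν i)).comp (tendsto_window hα.sum_eq_top x)
  -- Each window jump strictly increases the potential: `A` gains more than `x / 2`, while the
  -- endpoint term of clock `i` costs less than `κ * x / 2`. This contradicts the maximum.
  have hstep : ∀ᶠ n in atTop, a i n - c * a j n + κ * A n <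
      a i (window α n x) - c * a j (window α n x) + κ * A (window α n x) := by
    have hpos : 0 < κ * x / 2 := by positivity
    filter_upwards [hev, hνN.eventually_lt_const hpos,
      hα.tendsto_zero.eventually_lt_const (half_pos hx)] with n hn hn1 hn2
    obtain ⟨hw1, hw2⟩ := window_spec hα.sum_eq_top n x
    rw [sum_Icc_eq_sub _ (by omega)] at hw2
    have hm : ∀ l, updateCount Y n l ω ≤ updateCount Y (window α n x) l ω + 1 := fun l =>
      (updateCount_mono (i := l) hw1.le).trans (Nat.le_succ _)
    rw [sum_Icc_eq_sub _ (hm j), sum_Icc_eq_sub _ (hm i), Finset.sum_range_succ,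
      Finset.sum_range_succ] at hn
    have hA1 : A n = ∑ k ∈ Finset.range n, α k + α n := Finset.sum_range_succ _ _
    have h3 : κ * (x / 2) < κ * (A (window α n x) - A n) := by
      gcongr
      simp only [hAdef]
      linarith
    have h4 : 0 ≤ c * α (updateCount Y (window α n x) j ω) :=
      mul_nonneg (by linarith) (hα.pos _).le
    simp only [hadef]
    linarith
  obtain ⟨n₀, hn₀⟩ := eventually_atTop.1 hstep
  obtain ⟨n, hn, hmax⟩ := exists_max_of_tendsto_atBot hg n₀
  exact absurd (hn₀ n hn)
    (not_lt.2 (hmax _ (hn.trans (window_spec hα.sum_eq_top n x).1.le)))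

/-- A limit above `1` makes `i` strictly faster than `j`. A limit below `1` makes `j` faster than
`i`, with factor `c⁻¹`. -/
lemma window_ratio_limit_eq_one (hα : StepsizeCondition α) (hρ : 0 < ρ) (hρ1 : ρ < 1)
    (hν : ∀ᶠ n : ℕ in atTop, ∀ i : Fin d, ρ * n ≤ updateCount Y n i ω) (i j : Fin d)
    {x : ℝ} (hx : 0 < x) {l : ℝ}
    (hl : Tendsto (fun n : ℕ =>
        (∑ k ∈ Finset.Icc (updateCount Y n i ω) (updateCount Y (window α n x) i ω), α k) /
          ∑ k ∈ Finset.Icc (updateCount Y n j ω) (updateCount Y (window α n x) j ω), α k)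
      atTop (𝓝 l)) : l = 1 := by
  have hpos : ∀ (i : Fin d) n, 0 <
      ∑ k ∈ Finset.Icc (updateCount Y n i ω) (updateCount Y (window α n x) i ω), α k :=
    fun i n => Finset.sum_pos (fun k _ => hα.pos k)
      (Finset.nonempty_Icc.2 (updateCount_mono (window_spec hα.sum_eq_top n x).1.le))
  have hl0 : 0 ≤ l := ge_of_tendsto' hl fun n => (div_pos (hpos i n) (hpos j n)).le
  refine le_antisymm ?_ ?_
  · by_contra! h
    obtain ⟨c, hc1, hcl⟩ := exists_between h
    refine not_eventually_window_sum_ge hα hρ hρ1 hν i j hx hc1 ?_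
    filter_upwards [hl.eventually_const_lt hcl] with n hn
    exact ((lt_div_iff₀ (hpos j n)).1 hn).le
  · by_contra! h
    obtain ⟨c, hcl, hc1⟩ := exists_between h
    have hc0 : 0 < c := hl0.trans_lt hcl
    refine not_eventually_window_sum_ge hα hρ hρ1 hν j i hx ((one_lt_inv₀ hc0).2 hc1) ?_
    filter_upwards [hl.eventually_lt_const hcl] with n hn
    rw [inv_mul_le_iff₀ hc0]
    exact ((div_lt_iff₀ (hpos j n)).1 hn).le

/-- Over windows of fixed length all the local clocks advance by asymptotically equal amounts. -/
lemma tendsto_window_clock_diff (hα : StepsizeCondition α) (hρ : 0 < ρ) (hρ1 : ρ < 1)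
    (hν : ∀ᶠ n : ℕ in atTop, ∀ i : Fin d, ρ * n ≤ updateCount Y n i ω) (hC : 0 < C)
    (hβ : ∀ᶠ n in atTop, ∀ i, updateStep α Y n i ω ≤ C * α n) (i j : Fin d)
    {x : ℝ} (hx : 0 < x) {l : ℝ}
    (hl : Tendsto (fun n : ℕ =>
        (∑ k ∈ Finset.Icc (updateCount Y n i ω) (updateCount Y (window α n x) i ω), α k) /
          ∑ k ∈ Finset.Icc (updateCount Y n j ω) (updateCount Y (window α n x) j ω), α k)
      atTop (𝓝 l)) :
    Tendsto (fun n => ∑ k ∈ Finset.Ico n (window α n x),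
      (updateStep α Y k i ω - updateStep α Y k j ω)) atTop (𝓝 0) := by
  set D : Fin d → ℕ → ℝ := fun i n =>
    ∑ k ∈ Finset.Icc (updateCount Y n i ω) (updateCount Y (window α n x) i ω), α k with hD
  have hN := fun n => window_spec hα.sum_eq_top n x
  have hνN : ∀ i, Tendsto (fun n => α (updateCount Y (window α n x) i ω)) atTop (𝓝 0) := fun i =>
    (hα.tendsto_zero.comp (tendsto_updateCount hρ hν i)).comp (tendsto_window hα.sum_eq_top x)
  have hDeq : ∀ i n, D i n = ∑ k ∈ Finset.Ico n (window α n x), updateStep α Y k i ω +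
      α (updateCount Y (window α n x) i ω) := fun i n => by
    rw [sum_Ico_updateStep (hN n).1.le, hD]
    simp only
    rw [sum_Icc_eq_sub _ ((updateCount_mono (i := i) (hN n).1.le).trans (Nat.le_succ _)),
      Finset.sum_range_succ]
    ring
  have hDpos : ∀ i n, 0 < D i n := fun i n => Finset.sum_pos (fun k _ => hα.pos k)
      (Finset.nonempty_Icc.2 (updateCount_mono (hN n).1.le))
  have hDbdd : ∀ᶠ n in atTop, D j n ≤ C * (x + 1) + 1 := by
    obtain ⟨N, hβN⟩ := eventually_atTop.1 hβ
    filter_upwards [eventually_ge_atTop N, (hνN j).eventually_le_const one_pos,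
      hα.tendsto_zero.eventually_le_const one_pos] with n hn hn1 hn2
    rw [hDeq]
    refine add_le_add ?_ hn1
    calc _ ≤ ∑ k ∈ Finset.Ico n (window α n x), C * α k :=
          Finset.sum_le_sum fun k hk => hβN k (hn.trans (Finset.mem_Ico.1 hk).1) j
      _ = C * ∑ k ∈ Finset.Ico n (window α n x), α k := by rw [Finset.mul_sum]
      _ ≤ C * (x + 1) := by
          gcongr
          -- Minimality of the window says nothing when it ends at `n + 1`. The single step `α n ≤
          -- 1` is then bounded directly, whence `x + 1`.
          rcases (Nat.succ_le_of_lt (hN n).1).eq_or_lt with h | h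
          · rw [← h]
            simp only [Nat.succ_eq_add_one, Nat.Ico_succ_singleton, Finset.sum_singleton]
            linarith
          · obtain ⟨m, hm⟩ : ∃ m, window α n x = m + 1 := ⟨window α n x - 1, by omega⟩
            have := sum_lt_of_lt_window (α := α) (n := n) (m := m) (x := x) (by omega) (by omega)
            rw [hm]
            have h2 : Finset.Ico n (m + 1) = Finset.Icc n m := rfl
            rw [h2]
            linarith
  have h1 : Tendsto (fun n => (D i n / D j n - 1) * D j n) atTop (𝓝 0) := by
    have hl1 := window_ratio_limit_eq_one hα hρ hρ1 hν i j hx hl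
    subst hl1
    have h0 : Tendsto (fun n => D i n / D j n - 1) atTop (𝓝 0) := by simpa using hl.sub_const 1
    refine h0.zero_mul_isBoundedUnder_le ?_
    refine ⟨C * (x + 1) + 1, ?_⟩
    rw [eventually_map]
    filter_upwards [hDbdd] with n hn
    simpa [abs_of_pos (hDpos j n)] using hn
  have h2 := (h1.sub (hνN i)).add (hνN j)
  simp only [sub_zero, add_zero] at h2
  refine h2.congr fun n => ?_
  rw [sub_mul, div_mul_cancel₀ _ (hDpos j n).ne', hDeq, hDeq, Finset.sum_sub_distrib]
  ring

/-- A cumulative sum with small increments over all windows of a small length has small increments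
over all bounded time intervals. -/
lemma eventually_abs_sum_le_of_window (hα : StepsizeCondition α) {f : ℕ → ℝ} (hC : 0 < C)
    (hf : ∀ᶠ n in atTop, |f n| ≤ C * α n)
    (hw : ∀ q : ℕ, Tendsto (fun n => ∑ k ∈ Finset.Ico n (window α n (1 / (q + 1))), f k)
      atTop (𝓝 0)) {ε : ℝ} (hε : 0 < ε) (T : ℝ) :
    ∀ᶠ n in atTop, ∀ m ≥ n, ∑ k ∈ Finset.Ico n m, α k ≤ T → |∑ k ∈ Finset.Ico n m, f k| ≤ ε := by
  wlog hT : 0 ≤ T generalizing T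
  · filter_upwards [this 0 le_rfl] with n hn m hm h
    exact hn m hm (h.trans (not_le.1 hT).le)
  obtain ⟨q, hq⟩ := exists_nat_one_div_lt (show 0 < ε / (2 * C) by positivity)
  set x : ℝ := 1 / ((q : ℝ) + 1) with hxdef
  have hx : 0 < x := by positivity
  have hCx : C * x ≤ ε / 2 := by
    have : C * x ≤ C * (ε / (2 * C)) := by gcongr
    refine this.trans_eq ?_
    field_simp
  set η : ℝ := ε / 2 / (2 * T / x + 1) with hη
  have hη0 : 0 < η := by positivity
  have hwη : ∀ᶠ n in atTop, |∑ k ∈ Finset.Ico n (window α n x), f k| ≤ η := by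
    have := (hw q).abs
    rw [abs_zero] at this
    exact this.eventually_le_const hη0
  obtain ⟨N, hN⟩ := eventually_atTop.1 (hf.and (hwη.and
    (hα.tendsto_zero.eventually_le_const (half_pos hx))))
  -- Windows of length `x` are peeled off one at a time. Each full one contributes at most `η` and
  -- uses at least `x / 2` of global time; the final incomplete one contributes at most `C * x ≤ ε /
  -- 2`.
  have key : ∀ r n m : ℕ, m - n ≤ r → N ≤ n → n ≤ m →
      |∑ k ∈ Finset.Ico n m, f k| ≤ ε / 2 + η * (2 / x * ∑ k ∈ Finset.Ico n m, α k) := by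
    intro r
    induction r with
    | zero =>
      intro n m h1 _ h3
      obtain rfl : n = m := by omega
      simp only [Finset.Ico_self, Finset.sum_empty, abs_zero, mul_zero, add_zero]
      positivity
    | succ r ih =>
      intro n m hr hNn hnm
      obtain ⟨hw1, hw2⟩ := window_spec hα.sum_eq_top n x
      have hsum0 : ∀ a b, 0 ≤ ∑ k ∈ Finset.Ico a b, α k := fun a b =>
        Finset.sum_nonneg fun k _ => (hα.pos k).le
      rcases lt_or_ge m (window α n x) with h | h
      · have h1 : ∑ k ∈ Finset.Ico n m, α k ≤ x := by
          rcases hnm.eq_or_lt with rfl | hlt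
          · simpa using hx.le
          · refine le_trans ?_ (sum_lt_of_lt_window hlt h).le
            exact Finset.sum_le_sum_of_subset_of_nonneg Finset.Ico_subset_Icc_self
              fun k _ _ => (hα.pos k).le
        have h2 : |∑ k ∈ Finset.Ico n m, f k| ≤ C * x := by
          calc _ ≤ ∑ k ∈ Finset.Ico n m, |f k| := Finset.abs_sum_le_sum_abs _ _
            _ ≤ ∑ k ∈ Finset.Ico n m, C * α k :=
                Finset.sum_le_sum fun k hk => (hN k (hNn.trans (Finset.mem_Ico.1 hk).1)).1
            _ = C * ∑ k ∈ Finset.Ico n m, α k := by rw [Finset.mul_sum]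
            _ ≤ _ := by gcongr
        have h3 : 0 ≤ η * (2 / x * ∑ k ∈ Finset.Ico n m, α k) := by
          have := hsum0 n m
          positivity
        linarith
      · have ih' := ih (window α n x) m (by omega) (by omega) h
        rw [← Finset.sum_Ico_consecutive f hw1.le h, ← Finset.sum_Ico_consecutive α hw1.le h]
        have h1 : x / 2 ≤ ∑ k ∈ Finset.Ico n (window α n x), α k := by
          have h2 : Finset.Icc n (window α n x) = Finset.Ico n (window α n x + 1) := rfl
          rw [h2, Finset.sum_Ico_succ_top hw1.le] at hw2
          linarith [(hN (window α n x) (by omega)).2.2]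
        have h2 : η * 1 ≤ η * (2 / x * ∑ k ∈ Finset.Ico n (window α n x), α k) := by
          gcongr
          calc (1 : ℝ) = 2 / x * (x / 2) := by field_simp
            _ ≤ _ := by gcongr
        refine (abs_add_le _ _).trans ?_
        have h3 := (hN n hNn).2.1
        rw [mul_add, mul_add]
        linarith
  filter_upwards [eventually_ge_atTop N] with n hn m hm hmT
  refine (key _ n m le_rfl hn hm).trans ?_
  have h1 : η * (2 / x * ∑ k ∈ Finset.Ico n m, α k) ≤ η * (2 * T / x + 1) := by
    gcongr
    have : 2 / x * ∑ k ∈ Finset.Ico n m, α k ≤ 2 / x * T := by gcongr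
    have h2 : 2 / x * T = 2 * T / x := by ring
    linarith
  have h2 : η * (2 * T / x + 1) = ε / 2 := by
    rw [hη]
    have : 2 * T / x + 1 ≠ 0 := by positivity
    field_simp
  linarith

end Asynchrony

/-! ### Convergence of martingale transforms. -/

/-- The measures with densities `X` and `condLExp m μ X` coincide on `m`, so they integrate
`m`-measurable functions alike. -/
lemma lintegral_mul_condLExp {Ω : Type*} {m mΩ : MeasurableSpace Ω} (hm : m ≤ mΩ) (μ : Measure Ω)
    [IsFiniteMeasure μ] {X g : Ω → ENNReal} (hX : Measurable X) (hg : Measurable[m] g) :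
    ∫⁻ ω, X ω * g ω ∂μ = ∫⁻ ω, condLExp m μ X ω * g ω ∂μ := by
  have hg' : Measurable g := hg.mono hm le_rfl
  have hc : Measurable (condLExp m μ X) := measurable_condLExp' m μ X
  have h : (μ.withDensity X).trim hm = (μ.withDensity (condLExp m μ X)).trim hm := by
    refine @Measure.ext Ω m _ _ fun s hs => ?_
    rw [trim_measurableSet_eq hm hs, trim_measurableSet_eq hm hs, withDensity_apply _ (hm s hs),
      withDensity_apply _ (hm s hs), setLIntegral_condLExp hm μ X hs]
  have h1 := lintegral_withDensity_eq_lintegral_mul μ hX hg'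
  have h2 := lintegral_withDensity_eq_lintegral_mul μ hc hg'
  simp only [Pi.mul_apply] at h1 h2
  rw [← h1, ← h2, ← lintegral_trim hm hg, h, lintegral_trim hm hg]

/-- Almost sure convergence of a series of martingale differences with bounded total variance. -/
lemma ae_exists_tendsto_sum_of_sq_bounded {Ω : Type*} {mΩ : MeasurableSpace Ω} {μ : Measure Ω}
    [IsProbabilityMeasure μ] {F : Filtration ℕ mΩ} {ξ : ℕ → Ω → ℝ}
    (hmeas : ∀ n, Measurable[F (n + 1)] (ξ n)) (hL2 : ∀ n, MemLp (ξ n) 2 μ)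
    (hzero : ∀ n, μ[ξ n | F n] =ᵐ[μ] 0) {R : ℝ}
    (hR : ∀ n, ∑ k ∈ Finset.range n, ∫ ω, ξ k ω ^ 2 ∂μ ≤ R) :
    ∀ᵐ ω ∂μ, ∃ l, Tendsto (fun n => ∑ k ∈ Finset.range n, ξ k ω) atTop (𝓝 l) := by
  set S : ℕ → Ω → ℝ := fun n ω => ∑ k ∈ Finset.range n, ξ k ω with hS
  have hsucc : ∀ n, S (n + 1) = S n + ξ n := fun n => by
    funext ω; exact Finset.sum_range_succ _ _
  have hSmeas : ∀ n, Measurable[F n] (S n) := fun n =>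
    Finset.measurable_sum _ fun k hk =>
      (hmeas k).mono (F.mono (Finset.mem_range.1 hk)) le_rfl
  have hSL2 : ∀ n, MemLp (S n) 2 μ := fun n => memLp_finsetSum _ fun k _ => hL2 k
  have hint : ∀ n, Integrable (ξ n) μ := fun n => (hL2 n).integrable (by norm_num)
  have hSint : ∀ n, Integrable (S n) μ := fun n => (hSL2 n).integrable (by norm_num)
  have hmart : Martingale S F μ := by
    refine martingale_nat (fun n => (hSmeas n).stronglyMeasurable) hSint fun n => ?_
    rw [hsucc]
    have h1 := condExp_add (hSint n) (hint n) (F n)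
    rw [condExp_of_stronglyMeasurable (F.le n) (hSmeas n).stronglyMeasurable (hSint n)] at h1
    filter_upwards [h1, hzero n] with ω h1 h2
    rw [h1, Pi.add_apply, h2]
    simp
  -- Martingale increments are orthogonal. The second moment then bounds the `L¹` norm through `|s|
  -- ≤ 1 + s ^ 2`.
  have hsq : ∀ n, ∫ ω, S n ω ^ 2 ∂μ ≤ ∑ k ∈ Finset.range n, ∫ ω, ξ k ω ^ 2 ∂μ := by
    intro n
    induction n with
    | zero => simp [hS]
    | succ n ih =>
      have hprod : Integrable (S n * ξ n) μ := (hSL2 n).integrable_mul (hL2 n)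
      have hcross : ∫ ω, (S n * ξ n) ω ∂μ = 0 := by
        rw [← integral_condExp (F.le n)]
        refine integral_eq_zero_of_ae ?_
        filter_upwards [condExp_mul_of_stronglyMeasurable_left (hSmeas n).stronglyMeasurable
          hprod (hint n), hzero n] with ω h1 h2
        rw [h1, Pi.mul_apply, h2]
        simp
      have hexp : ∀ ω, S (n + 1) ω ^ 2 = S n ω ^ 2 + 2 * (S n * ξ n) ω + ξ n ω ^ 2 := fun ω => by
        rw [hsucc, Pi.add_apply, Pi.mul_apply]; ring
      simp_rw [hexp]
      have hint₁ : Integrable (fun ω => S n ω ^ 2 + 2 * (S n * ξ n) ω) μ :=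
        (hSL2 n).integrable_sq.add (hprod.const_mul 2)
      rw [integral_add hint₁ (hL2 n).integrable_sq,
        integral_add (hSL2 n).integrable_sq (hprod.const_mul 2), integral_const_mul, hcross,
        Finset.sum_range_succ]
      linarith
  refine hmart.submartingale.exists_ae_tendsto_of_bdd (R := (1 + R).toNNReal) fun n => ?_
  rw [eLpNorm_one_eq_lintegral_enorm, ← ofReal_integral_norm_eq_lintegral_enorm (hSint n)]
  refine ENNReal.ofReal_le_ofReal ?_
  calc ∫ ω, ‖S n ω‖ ∂μ ≤ ∫ ω, (1 + S n ω ^ 2) ∂μ := by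
        refine integral_mono (hSint n).norm ((integrable_const _).add (hSL2 n).integrable_sq)
          fun ω => ?_
        simp only [Real.norm_eq_abs]
        nlinarith [sq_abs (S n ω), sq_nonneg (|S n ω| - 1)]
    _ = 1 + ∫ ω, S n ω ^ 2 ∂μ := by
        rw [integral_add (integrable_const _) (hSL2 n).integrable_sq]; simp
    _ ≤ 1 + R := by linarith [hsq n, hR n]

/-- Almost sure convergence of a martingale transform with predictable weights `c`. -/
lemma ae_exists_tendsto_sum_mul {Ω : Type*} {mΩ : MeasurableSpace Ω} {μ : Measure Ω}
    [IsProbabilityMeasure μ] {F : Filtration ℕ mΩ} {X c V e : ℕ → Ω → ℝ} {b R : ℝ}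
    (hX : ∀ n, Measurable[F (n + 1)] (X n)) (hXint : ∀ n, Integrable (X n) μ)
    (hzero : ∀ n, μ[X n | F n] =ᵐ[μ] 0) (hc : ∀ n, Measurable[F n] (c n))
    (hcb : ∀ n ω, |c n ω| ≤ b)
    (hV : ∀ n, ∀ᵐ ω ∂μ, condLExp (F n) μ (fun ω' => ENNReal.ofReal (X n ω' ^ 2)) ω
      ≤ ENNReal.ofReal (V n ω))
    (he : ∀ n, Measurable (e n)) (he0 : ∀ n ω, 0 ≤ e n ω)
    (hce : ∀ n ω, c n ω ^ 2 * V n ω ≤ e n ω)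
    (hR : ∀ n ω, ∑ k ∈ Finset.range n, e k ω ≤ R) :
    ∀ᵐ ω ∂μ, ∃ l, Tendsto (fun n => ∑ k ∈ Finset.range n, c k ω * X k ω) atTop (𝓝 l) := by
  have hXm : ∀ n, Measurable (X n) := fun n => (hX n).mono (F.le _) le_rfl
  have hcm : ∀ n, Measurable (c n) := fun n => (hc n).mono (F.le _) le_rfl
  have heR : ∀ n ω, e n ω ≤ R := fun n ω =>
    (Finset.single_le_sum (f := fun k => e k ω) (fun k _ => he0 k ω)
      (Finset.self_mem_range_succ n)).trans (hR (n + 1) ω)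
  have heint : ∀ n, Integrable (e n) μ := fun n =>
    Integrable.of_bound (he n).aestronglyMeasurable R
      (ae_of_all _ fun ω => by rw [Real.norm_of_nonneg (he0 n ω)]; exact heR n ω)
  -- Taking `c n ^ 2` out of the conditional expectation in `[0, ∞]` proves that `c n * X n` is
  -- square integrable, although `X n` need not be.
  have hlin : ∀ n, ∫⁻ ω, ENNReal.ofReal ((c n ω * X n ω) ^ 2) ∂μ ≤ ENNReal.ofReal (∫ ω, e n ω ∂μ) := by
    intro n
    have hXsq : Measurable fun ω => ENNReal.ofReal (X n ω ^ 2) := ((hXm n).pow_const 2).ennreal_ofReal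
    have hcsq : Measurable[F n] fun ω => ENNReal.ofReal (c n ω ^ 2) :=
      ((hc n).pow_const 2).ennreal_ofReal
    rw [ofReal_integral_eq_lintegral_ofReal (heint n) (ae_of_all _ (he0 n))]
    calc _ = ∫⁻ ω, ENNReal.ofReal (X n ω ^ 2) * ENNReal.ofReal (c n ω ^ 2) ∂μ := by
          refine lintegral_congr fun ω => ?_
          rw [← ENNReal.ofReal_mul (sq_nonneg _)]
          congr 1
          ring
      _ = _ := lintegral_mul_condLExp (F.le n) μ hXsq hcsq
      _ ≤ _ := by
          refine lintegral_mono_ae ?_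
          filter_upwards [hV n] with ω hω
          calc _ ≤ ENNReal.ofReal (V n ω) * ENNReal.ofReal (c n ω ^ 2) := by gcongr
            _ = ENNReal.ofReal (c n ω ^ 2 * V n ω) := by
                rw [mul_comm, ENNReal.ofReal_mul (sq_nonneg _)]
            _ ≤ _ := ENNReal.ofReal_le_ofReal (hce n ω)
  have hξm : ∀ n, Measurable fun ω => c n ω * X n ω := fun n => (hcm n).mul (hXm n)
  have hint : ∀ n, Integrable (fun ω => c n ω * X n ω) μ := fun n =>
    (hXint n).bdd_mul (hcm n).aestronglyMeasurable (ae_of_all _ (hcb n))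
  have hsqint : ∀ n, Integrable (fun ω => (c n ω * X n ω) ^ 2) μ := fun n => by
    refine ⟨((hξm n).pow_const 2).aestronglyMeasurable, ?_⟩
    rw [hasFiniteIntegral_iff_ofReal (ae_of_all _ fun ω => sq_nonneg _)]
    exact (hlin n).trans_lt ENNReal.ofReal_lt_top
  have hsq : ∀ n, ∫ ω, (c n ω * X n ω) ^ 2 ∂μ ≤ ∫ ω, e n ω ∂μ := fun n => by
    rw [integral_eq_lintegral_of_nonneg_ae (ae_of_all _ fun ω => sq_nonneg _)
      (hsqint n).aestronglyMeasurable]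
    exact ENNReal.toReal_le_of_le_ofReal (integral_nonneg (he0 n)) (hlin n)
  refine ae_exists_tendsto_sum_of_sq_bounded (F := F) (μ := μ) (R := R)
    (ξ := fun n ω => c n ω * X n ω)
    (fun n => ((hc n).mono (F.mono (Nat.le_succ n)) le_rfl).mul (hX n))
    (fun n => (memLp_two_iff_integrable_sq (hξm n).aestronglyMeasurable).2 (hsqint n))
    (fun n => ?_) fun n => ?_
  · filter_upwards [condExp_mul_of_stronglyMeasurable_left (hc n).stronglyMeasurable
      (hint n) (hXint n), hzero n] with ω h1 h2
    refine Eq.trans h1 ?_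
    rw [Pi.mul_apply, h2]
    simp
  · calc _ ≤ ∑ k ∈ Finset.range n, ∫ ω, e k ω ∂μ := Finset.sum_le_sum fun k _ => hsq k
      _ = ∫ ω, ∑ k ∈ Finset.range n, e k ω ∂μ := (integral_finsetSum _ fun k _ => heint k).symm
      _ ≤ ∫ _, R ∂μ := integral_mono (integrable_finsetSum _ fun k _ => heint k)
          (integrable_const _) (hR n)
      _ = R := by simp

/-! ### Time windows and the truncated, rescaled noise. -/

/-- Start of the current time window: a new window begins once the stepsizes accumulated since the
start of the present one reach `T`. -/
noncomputable def windowStart (α : ℕ → ℝ) (T : ℝ) : ℕ → ℕ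
  | 0 => 0
  | n + 1 => open Classical in
    if T ≤ ∑ k ∈ Finset.Ico (windowStart α T n) (n + 1), α k then n + 1 else windowStart α T n

lemma windowStart_le (α : ℕ → ℝ) (T : ℝ) (n : ℕ) : windowStart α T n ≤ n := by
  induction n with
  | zero => exact le_rfl
  | succ n ih =>
    rw [windowStart]
    split_ifs <;> omega

/-- Scaled, truncated weights of the noise. -/
noncomputable def noiseWeight {Ω : Type*} {d : ℕ} (α : ℕ → ℝ) (T : ℝ) (Y : ℕ → Ω → Finset (Fin d))
    (x : ℕ → Ω → Fin d → ℝ) (K : ℕ → Ω → ℝ) (q : ℕ) (i : Fin d) (n : ℕ) (ω : Ω) : ℝ :=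
  open Classical in
  if ‖x n ω‖ ≤ q * max ‖x (windowStart α T n) ω‖ 1 ∧ K n ω ≤ q then
    updateStep α Y n i ω / max ‖x (windowStart α T n) ω‖ 1 else 0

section Noise

variable {Ω : Type*} {mΩ : MeasurableSpace Ω} {d : ℕ} {F : Filtration ℕ mΩ} {α : ℕ → ℝ}
  {h : (Fin d → ℝ) → (Fin d → ℝ)} {Y : ℕ → Ω → Finset (Fin d)} {M ε x : ℕ → Ω → Fin d → ℝ}
  {K δ : ℕ → Ω → ℝ}

lemma IsAsyncSA.measurable_updateStep (hAlg : IsAsyncSA F α h Y M ε x) (n : ℕ) (i : Fin d) :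
    Measurable[F n] (updateStep α Y n i) := by
  have hν : Measurable[F n] (updateCount Y n i) := by
    refine Finset.measurable_sum _ fun k hk => ?_
    exact Measurable.ite (F.mono (Finset.mem_range.1 hk).le _ (hAlg.adapted_Y k i))
      measurable_const measurable_const
  exact Measurable.ite (hAlg.adapted_Y n i) ((measurable_of_countable α).comp hν) measurable_const

open Classical in
lemma measurable_ite_div_max {Ω : Type*} {_ : MeasurableSpace Ω} {d : ℕ} {f g : Ω → Fin d → ℝ}
    {k b : Ω → ℝ} (hf : Measurable f) (hg : Measurable g) (hk : Measurable k) (hb : Measurable b)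
    (q : ℝ) :
    Measurable fun ω => if ‖f ω‖ ≤ q * max ‖g ω‖ 1 ∧ k ω ≤ q then b ω / max ‖g ω‖ 1 else 0 := by
  have hr : Measurable fun ω => max ‖g ω‖ 1 := hg.norm.max measurable_const
  refine Measurable.ite ?_ (hb.div hr) measurable_const
  exact (measurableSet_le hf.norm (hr.const_mul _)).inter (measurableSet_le hk measurable_const)

/-- Window starts are deterministic and never exceed `n`, so the normalization is known at time `n`.
-/
lemma IsAsyncSA.measurable_noiseWeight (hAlg : IsAsyncSA F α h Y M ε x)
    (hK : ∀ n, Measurable[F n] (K n)) (T : ℝ) (q : ℕ) (i : Fin d) (n : ℕ) :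
    Measurable[F n] (noiseWeight α T Y x K q i n) := by
  exact measurable_ite_div_max (hAlg.adapted_x n)
    ((hAlg.adapted_x _).mono (F.mono (windowStart_le α T n)) le_rfl) (hK n)
    (hAlg.measurable_updateStep n i) q

/-- On the truncation event `K ≤ q` and `1 + ‖x‖ ^ 2 ≤ (1 + q ^ 2) * r ^ 2`, where `r` is the
denominator of the weight, so `r ^ 2` cancels. -/
lemma sq_noiseWeight_mul_le (T : ℝ) (q : ℕ) (i : Fin d) (n : ℕ) (ω : Ω) :
    noiseWeight α T Y x K q i n ω ^ 2 * (K n ω * (1 + ‖x n ω‖ ^ 2)) ≤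
      q * (1 + q ^ 2) * updateStep α Y n i ω ^ 2 := by
  unfold noiseWeight
  split_ifs with hc
  · obtain ⟨h1, h2⟩ := hc
    set r := max ‖x (windowStart α T n) ω‖ 1
    have hr : 1 ≤ r := le_max_right _ _
    have hr0 : 0 < r := by linarith
    have h3 : 1 + ‖x n ω‖ ^ 2 ≤ (1 + q ^ 2) * r ^ 2 := by
      have h4 : ‖x n ω‖ ^ 2 ≤ (q * r) ^ 2 := by gcongr
      nlinarith
    calc _ ≤ (updateStep α Y n i ω / r) ^ 2 * (q * ((1 + q ^ 2) * r ^ 2)) := by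
          gcongr
      _ = _ := by field_simp
  · rw [zero_pow two_ne_zero, zero_mul]
    positivity

lemma abs_noiseWeight_le (hα : ∀ n, 0 < α n) {b : ℝ} (hb : ∀ n, α n ≤ b) (T : ℝ) (q : ℕ)
    (i : Fin d) (n : ℕ) (ω : Ω) : |noiseWeight α T Y x K q i n ω| ≤ b := by
  have hb0 : 0 ≤ b := (hα 0).le.trans (hb 0)
  unfold noiseWeight
  split_ifs
  · have h0 : 0 ≤ updateStep α Y n i ω := updateStep_nonneg hα n
    rw [abs_of_nonneg (by positivity)]
    refine (div_le_self h0 (le_max_right _ _)).trans ?_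
    unfold updateStep
    split_ifs
    exacts [hb _, hb0]
  · simpa using hb0

lemma ae_exists_tendsto_noise {μ : Measure Ω} [IsProbabilityMeasure μ]
    (hAlg : IsAsyncSA F α h Y M ε x) (hNoise : NoiseCondition μ F M ε x K δ)
    (hStep : StepsizeCondition α) (T : ℝ) (q : ℕ) (i : Fin d) :
    ∀ᵐ ω ∂μ, ∃ l, Tendsto (fun n => ∑ k ∈ Finset.range n,
      noiseWeight α T Y x K q i k ω * M (k + 1) ω i) atTop (𝓝 l) := by
  obtain ⟨b, hb⟩ := hStep.tendsto_zero.bddAbove_range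
  refine ae_exists_tendsto_sum_mul (F := F) (b := b) (R := q * (1 + q ^ 2) * ∑' k, α k ^ 2)
    (X := fun n ω => M (n + 1) ω i) (V := fun n ω => K n ω * (1 + ‖x n ω‖ ^ 2))
    (e := fun n ω => q * (1 + q ^ 2) * updateStep α Y n i ω ^ 2)
    (fun n => (measurable_pi_apply i).comp (hAlg.adapted_M (n + 1)))
    (fun n => (hNoise.integrable n).eval i) (fun n => ?_)
    (fun n => hAlg.measurable_noiseWeight hNoise.measurable_K T q i n)
    (fun n ω => abs_noiseWeight_le hStep.pos (fun k => hb ⟨k, rfl⟩) T q i n ω)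
    (fun n => ?_)
    (fun n => (((hAlg.measurable_updateStep n i).mono (F.le n) le_rfl).pow_const 2).const_mul _)
    (fun n ω => by positivity)
    (fun n ω => sq_noiseWeight_mul_le T q i n ω) fun n ω => ?_
  · have h1 := (ContinuousLinearMap.proj (R := ℝ) (φ := fun _ : Fin d => ℝ) i).comp_condExp_comm
      (m := F n) (hNoise.integrable n)
    filter_upwards [h1, hNoise.condExp_eq_zero n] with ω h1 h2
    refine h1.symm.trans ?_
    simp [h2]
  · have h1 := condLExp_mono (mΩ := F n) (P := μ)
      (X := fun ω' => ENNReal.ofReal (M (n + 1) ω' i ^ 2))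
      (Y := fun ω' => ENNReal.ofReal (‖M (n + 1) ω'‖ ^ 2)) (ae_of_all _ fun ω => by
        refine ENNReal.ofReal_le_ofReal ?_
        rw [← sq_abs]
        gcongr
        exact norm_le_pi_norm (M (n + 1) ω) i)
    filter_upwards [h1, hNoise.condVar_le n] with ω h1 h2
    exact h1.trans h2
  · rw [← Finset.mul_sum]
    gcongr
    have h1 := sum_updateCount (Y := Y) (ω := ω) (i := i) (fun k => α k ^ 2) n
    have h2 : ∀ m, updateStep α Y m i ω ^ 2 =
        if i ∈ Y m ω then α (updateCount Y m i ω) ^ 2 else 0 := fun m => by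
      unfold updateStep
      split_ifs <;> simp
    simp_rw [h2]
    rw [h1]
    exact hStep.summable_sq.sum_le_tsum _ fun k _ => sq_nonneg _

end Noise

/-! ### Contraction over one window. -/

/-- On a single time window the iterates are controlled by their scaled initial value, and they
contract by the end of the window. -/
lemma norm_le_on_window {d : ℕ} (hd : 0 < d) {h g : (Fin d → ℝ) → (Fin d → ℝ)} {L : NNReal}
    (hg : LipschitzWith L g) (hg0 : g 0 = 0) {T : ℝ}
    (hT : ∀ z, IsSolution g z → ‖z 0‖ ≤ 1 → ∀ t, T ≤ t → ‖z t‖ < 1 / 4)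
    {x M ε β : ℕ → Fin d → ℝ} {α : ℕ → ℝ} {C S B η r : ℝ} {n₀ p : ℕ}
    (hS : 0 ≤ S) (hB : B = Real.exp (L * S)) (hη0 : 0 < η)
    (hη : η * (1 + 2 * S + L * B + 2 * (L ^ 2 * B * S)) * Real.exp (L * S) ≤ 1 / 4)
    (hr : 1 ≤ r) (hx0 : ‖x n₀‖ ≤ r)
    (hscale : ∀ u, ‖u‖ ≤ B + 1 → ‖r⁻¹ • h (r • u) - g u‖ ≤ η)
    (hupd : ∀ n i, x (n + 1) i = x n i + β n i * (h (x n) i + M (n + 1) i + ε (n + 1) i))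
    (hβ : ∀ n ≥ n₀, ∀ i, 0 ≤ β n i ∧ β n i ≤ C * α n)
    (hβsum : ∀ n ≥ n₀, α n ≤ ∑ i, β n i)
    (hαη : ∀ n ≥ n₀, C * α n ≤ η)
    (hε : ∀ n ≥ n₀, ‖ε (n + 1)‖ * (B + 2) ≤ η * (1 + ‖x n‖))
    (hasync : ∀ n ≤ p, ∀ i j,
      |∑ k ∈ Finset.range n, (β (n₀ + k) i - β (n₀ + k) j)| ≤ η)
    (hsum : C * ∑ k ∈ Finset.range p, α (n₀ + k) ≤ S)
    (hnoise : ∀ n ≤ p, (∀ k < n, ‖x (n₀ + k)‖ ≤ (B + 1) * r) →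
      ∀ i, |∑ k ∈ Finset.range n, β (n₀ + k) i * M (n₀ + k + 1) i| ≤ η * r) :
    ∀ n ≤ p, ‖x (n₀ + n)‖ ≤ (B + 1) * r ∧
      (d * T ≤ ∑ k ∈ Finset.range n, α (n₀ + k) → ‖x (n₀ + n)‖ ≤ r / 2) := by
  have hr0 : 0 < r := by linarith
  have hB0 : 0 < B := by rw [hB]; positivity
  have hd' : (0 : ℝ) < d := by exact_mod_cast hd
  set u : ℕ → Fin d → ℝ := fun k => r⁻¹ • x (n₀ + k) with hu
  have hnorm : ∀ k, ‖x (n₀ + k)‖ = ‖u k‖ * r := fun k => by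
    simp only [hu, norm_smul, norm_inv, Real.norm_of_nonneg hr0.le]
    field_simp
  have hxu : ∀ k, x (n₀ + k) = r • u k := fun k => by
    simp only [hu]
    rw [smul_inv_smul₀ hr0.ne']
  obtain ⟨z, hz0, hz⟩ := exists_isSolution hg hg0 (u 0)
  have hu0 : ‖u 0‖ ≤ 1 := by
    have := hnorm 0
    rw [add_zero] at this
    rw [this] at hx0
    exact le_of_mul_le_mul_right (by linarith) hr0
  have hzB : ∀ t ∈ Set.Icc 0 S, ‖z t‖ ≤ B := fun t ht => by
    refine (hz.norm_le hg hg0 ht.1).trans ?_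
    rw [hz0, hB]
    calc _ ≤ 1 * Real.exp (L * S) := by
          gcongr
          exact ht.2
      _ = _ := one_mul _
  -- The ODE runs on the average of the local clocks. Since `α n ≤ ∑ i, β n i`, this advances at
  -- least `1 / d` as fast as the global clock, so global time `d * T` guarantees ODE time `T`.
  set σ : ℕ → ℝ := fun k => (∑ i, β (n₀ + k) i) / d with hσ
  have hσ0 : ∀ k, 0 ≤ σ k := fun k =>
    div_nonneg (Finset.sum_nonneg fun i _ => (hβ _ (by omega) i).1) hd'.le
  have hσc : ∀ k, σ k ≤ C * α (n₀ + k) := fun k => by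
    rw [hσ, div_le_iff₀ hd']
    calc _ ≤ ∑ _i : Fin d, C * α (n₀ + k) := Finset.sum_le_sum fun i _ => (hβ _ (by omega) i).2
      _ = _ := by simp; ring
  intro n
  -- Tracking at step `n` uses the drift and noise bounds only at earlier steps, where the bound `(B
  -- + 1) * r` is already known.
  induction n using Nat.strong_induction_on with
  | _ n ih =>
  intro hn
  have ihx : ∀ k < n, ‖x (n₀ + k)‖ ≤ (B + 1) * r := fun k hk => (ih k hk (by omega)).1
  have ihu : ∀ k < n, ‖u k‖ ≤ B + 1 := fun k hk => by
    have := ihx k hk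
    rw [hnorm] at this
    exact le_of_mul_le_mul_right this hr0
  have hsn : ∑ k ∈ Finset.range n, C * α (n₀ + k) ≤ S := by
    refine le_trans ?_ hsum
    rw [Finset.mul_sum]
    exact Finset.sum_le_sum_of_subset_of_nonneg (Finset.range_mono hn)
      fun k _ _ => (hσ0 k).trans (hσc k)
  have htrack := hz.norm_sub_le_of_perturbed_euler hg hg0 (u := u) (b := fun k => β (n₀ + k))
    (G := fun k => r⁻¹ • h (x (n₀ + k))) (ξ := fun k i => r⁻¹ * (β (n₀ + k) i * M (n₀ + k + 1) i))
    (ζ := fun k i => r⁻¹ * (β (n₀ + k) i * ε (n₀ + k + 1) i)) (σ := σ)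
    (c := fun k => C * α (n₀ + k)) (n := n) hη0.le hS hz0
    (fun k _ => by
      funext i
      simp only [hu, Pi.add_apply, Pi.mul_apply, Pi.smul_apply, smul_eq_mul]
      rw [← add_assoc, hupd]
      ring)
    (fun k _ i => hβ _ (by omega) i) (fun k _ => ⟨hσ0 k, hσc k⟩) hsn hzB
    (fun k hk => by
      rw [hxu k]
      exact hscale _ (ihu k hk))
    (fun k hk => by
      have hc0 : 0 ≤ C * α (n₀ + k) := (hσ0 k).trans (hσc k)
      refine (pi_norm_le_iff_of_nonneg (by positivity)).2 fun i => ?_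
      have h1 := hε (n₀ + k) (by omega)
      have h2 : ‖ε (n₀ + k + 1)‖ ≤ η * r := by
        have h3 : ‖ε (n₀ + k + 1)‖ * (B + 2) ≤ η * r * (B + 2) := by
          refine h1.trans ?_
          have := ihx k hk
          have : η * (1 + ‖x (n₀ + k)‖) ≤ η * (r + (B + 1) * r) := by gcongr
          linarith
        exact le_of_mul_le_mul_right h3 (by linarith)
      obtain ⟨hb0, hb1⟩ := hβ (n₀ + k) (by omega) i
      rw [norm_mul, norm_mul, Real.norm_of_nonneg hb0, norm_inv, Real.norm_of_nonneg hr0.le]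
      calc _ ≤ r⁻¹ * (C * α (n₀ + k) * (η * r)) := by
            gcongr
            exact (norm_le_pi_norm _ i).trans h2
        _ = _ := by field_simp)
    (fun k hk => by
      refine (pi_norm_le_iff_of_nonneg hη0.le).2 fun i => ?_
      rw [Finset.sum_apply, ← Finset.mul_sum, norm_mul, norm_inv, Real.norm_of_nonneg hr0.le,
        Real.norm_eq_abs, inv_mul_le_iff₀ hr0, mul_comm r]
      exact hnoise k (by omega) (fun j hj => ihx j (by omega)) i)
    (fun k hk => by
      refine (pi_norm_le_iff_of_nonneg hη0.le).2 fun i => ?_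
      have h1 : (∑ j ∈ Finset.range k, (β (n₀ + j) - fun _ => σ j) : Fin d → ℝ) i =
          (∑ l : Fin d, ∑ j ∈ Finset.range k, (β (n₀ + j) i - β (n₀ + j) l)) / d := by
        rw [Finset.sum_comm, Finset.sum_apply, Finset.sum_div]
        refine Finset.sum_congr rfl fun j _ => ?_
        rw [Finset.sum_sub_distrib]
        simp only [Pi.sub_apply, hσ, Finset.sum_const, Finset.card_univ, Fintype.card_fin,
          nsmul_eq_mul]
        field_simp
      rw [h1, Real.norm_eq_abs, abs_div, abs_of_pos hd', div_le_iff₀ hd']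
      calc _ ≤ ∑ _l : Fin d, η := (Finset.abs_sum_le_sum_abs _ _).trans
            (Finset.sum_le_sum fun l _ => hasync k (by omega) i l)
        _ = _ := by simp; ring)
    (fun k _ => (hσc k).trans (hαη _ (by omega))) n le_rfl
  have hclose : ‖u n - z (∑ j ∈ Finset.range n, σ j)‖ ≤ 1 / 4 := htrack.trans hη
  have hun : ‖u n‖ ≤ ‖z (∑ j ∈ Finset.range n, σ j)‖ + 1 / 4 := by
    have := norm_le_norm_add_norm_sub' (u n) (z (∑ j ∈ Finset.range n, σ j))
    linarith
  constructor
  · rw [hnorm]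
    gcongr
    have := hzB (∑ j ∈ Finset.range n, σ j) ⟨Finset.sum_nonneg fun j _ => hσ0 j,
      (Finset.sum_le_sum fun j _ => hσc j).trans hsn⟩
    linarith
  · intro hdT
    have hTs : T ≤ ∑ j ∈ Finset.range n, σ j := by
      rw [hσ, ← Finset.sum_div, le_div_iff₀ hd', mul_comm]
      exact hdT.trans (Finset.sum_le_sum fun k _ => hβsum _ (by omega))
    have := hT z hz (by rw [hz0]; exact hu0) _ hTs
    rw [hnorm]
    have h2 : ‖u n‖ ≤ 1 / 2 := by linarith
    calc _ ≤ 1 / 2 * r := by gcongr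
      _ = _ := by ring

/-! ### Structure of the time windows. -/

section WindowStart

variable {α : ℕ → ℝ} {T : ℝ}

lemma windowStart_succ (n : ℕ) :
    (windowStart α T (n + 1) = n + 1 ∧ T ≤ ∑ k ∈ Finset.Ico (windowStart α T n) (n + 1), α k) ∨
    (windowStart α T (n + 1) = windowStart α T n ∧
      ∑ k ∈ Finset.Ico (windowStart α T n) (n + 1), α k < T) := by
  rw [windowStart]
  split_ifs with h
  · exact Or.inl ⟨rfl, h⟩
  · exact Or.inr ⟨rfl, not_le.1 h⟩

lemma sum_windowStart_lt (hT : 0 < T) (n : ℕ) :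
    ∑ k ∈ Finset.Ico (windowStart α T n) n, α k < T := by
  cases n with
  | zero => simpa using hT
  | succ n =>
    rcases windowStart_succ (α := α) (T := T) n with ⟨h, -⟩ | ⟨h, h'⟩
    · rw [h]; simpa using hT
    · rwa [h]

lemma windowStart_mono : Monotone (windowStart α T) :=
  monotone_nat_of_le_succ fun n => by
    have := windowStart_le α T n
    rcases windowStart_succ (α := α) (T := T) n with ⟨h, -⟩ | ⟨h, -⟩ <;> omega

lemma windowStart_idem (n : ℕ) : windowStart α T (windowStart α T n) = windowStart α T n := by
  induction n with
  | zero => rfl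
  | succ n ih =>
    rcases windowStart_succ (α := α) (T := T) n with ⟨h, -⟩ | ⟨h, -⟩
    · rw [h, h]
    · rw [h, ih]

lemma windowStart_eq_of_mem {n k : ℕ} (h1 : windowStart α T n ≤ k) (h2 : k ≤ n) :
    windowStart α T k = windowStart α T n :=
  le_antisymm (windowStart_mono h2)
    ((windowStart_idem n).symm.le.trans (windowStart_mono h1))

lemma tendsto_windowStart (hα : Tendsto (fun n => ∑ k ∈ Finset.range n, α k) atTop atTop)
    (hT : 0 < T) : Tendsto (windowStart α T) atTop atTop := by
  refine tendsto_atTop_atTop_of_monotone windowStart_mono fun N => ?_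
  by_contra! hlt
  obtain ⟨B, hB⟩ := ((Finset.range N).image fun m => ∑ k ∈ Finset.range m, α k).bddAbove
  obtain ⟨n, hn⟩ := (hα.eventually_ge_atTop (B + T)).exists
  have h1 := sum_windowStart_lt (α := α) hT n
  rw [Finset.sum_Ico_eq_sub _ (windowStart_le α T n)] at h1
  have h2 : ∑ k ∈ Finset.range (windowStart α T n), α k ≤ B := hB (Finset.mem_coe.2
    (Finset.mem_image.2 ⟨_, Finset.mem_range.2 (hlt n), rfl⟩))
  linarith

end WindowStart

lemma eventually_abs_sum_Ico_le {f : ℕ → ℝ} {l : ℝ}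
    (hf : Tendsto (fun n => ∑ k ∈ Finset.range n, f k) atTop (𝓝 l)) {η : ℝ} (hη : 0 < η) :
    ∀ᶠ n in atTop, ∀ m ≥ n, |∑ k ∈ Finset.Ico n m, f k| ≤ η := by
  obtain ⟨N, hN⟩ := Metric.cauchySeq_iff.1 hf.cauchySeq η hη
  filter_upwards [eventually_ge_atTop N] with n hn m hm
  rw [Finset.sum_Ico_eq_sub _ hm, ← Real.dist_eq]
  exact (hN m (le_trans hn hm) n hn).le

/-! ### Boundedness along a fixed path. -/

section Path

variable {Ω : Type*} {mΩ : MeasurableSpace Ω} {d : ℕ} {F : Filtration ℕ mΩ} {α : ℕ → ℝ}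
  {h hInf : (Fin d → ℝ) → (Fin d → ℝ)} {Y : ℕ → Ω → Finset (Fin d)} {M ε x : ℕ → Ω → Fin d → ℝ}
  {K δ : ℕ → Ω → ℝ} {ω : Ω}

lemma IsAsyncSA.update_eq (hAlg : IsAsyncSA F α h Y M ε x) (n : ℕ) (ω : Ω) (i : Fin d) :
    x (n + 1) ω i = x n ω i +
      updateStep α Y n i ω * (h (x n ω) i + M (n + 1) ω i + ε (n + 1) ω i) := by
  unfold updateStep
  split_ifs with hi
  · exact hAlg.update n ω i hi
  · rw [hAlg.no_update n ω i hi]; ring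

/-- Uniform asynchrony estimate: over bounded time intervals all the local clocks agree. -/
lemma eventually_abs_clock_diff_le (hα : StepsizeCondition α) {ρ C : ℝ} (hρ : 0 < ρ) (hρ1 : ρ < 1)
    (hν : ∀ᶠ n : ℕ in atTop, ∀ i : Fin d, ρ * n ≤ updateCount Y n i ω) (hC : 0 < C)
    (hβ : ∀ᶠ n in atTop, ∀ i, updateStep α Y n i ω ≤ C * α n)
    (hbal : ∀ (q : ℕ) (i j : Fin d), ∃ l : ℝ, Tendsto (fun n : ℕ =>
        (∑ k ∈ Finset.Icc (updateCount Y n i ω)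
          (updateCount Y (window α n (1 / (q + 1))) i ω), α k) /
          ∑ k ∈ Finset.Icc (updateCount Y n j ω)
            (updateCount Y (window α n (1 / (q + 1))) j ω), α k) atTop (𝓝 l))
    {η : ℝ} (hη : 0 < η) (T : ℝ) :
    ∀ᶠ n in atTop, ∀ i j : Fin d, ∀ m ≥ n, ∑ k ∈ Finset.Ico n m, α k ≤ T →
      |∑ k ∈ Finset.Ico n m, (updateStep α Y k i ω - updateStep α Y k j ω)| ≤ η := by
  rw [eventually_all]
  intro i
  rw [eventually_all]
  intro j
  refine eventually_abs_sum_le_of_window hα hC ?_ (fun q => ?_) hη T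
  · filter_upwards [hβ] with n hn
    have h1 := updateStep_nonneg (Y := Y) (ω := ω) (i := i) hα.pos n
    have h2 := updateStep_nonneg (Y := Y) (ω := ω) (i := j) hα.pos n
    rw [abs_le]
    constructor <;> linarith [hn i, hn j]
  · obtain ⟨l, hl⟩ := hbal q i j
    exact tendsto_window_clock_diff hα hρ hρ1 hν hC hβ i j (by positivity) hl

/-- Pathwise form of the stability theorem. -/
lemma exists_norm_le_of_path (hd : 0 < d) (hAlg : IsAsyncSA F α h Y M ε x)
    (hStep : StepsizeCondition α) (hDrift : DriftCondition h hInf) {L : NNReal}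
    (hg : LipschitzWith L hInf) {T : ℝ} (hT0 : 0 < T)
    (hT : ∀ z, IsSolution hInf z → ‖z 0‖ ≤ 1 → ∀ t, T ≤ t → ‖z t‖ < 1 / 4)
    (hnoise : ∀ (q : ℕ) (i : Fin d), ∃ l, Tendsto (fun n => ∑ k ∈ Finset.range n,
      noiseWeight α (d * T) Y x K q i k ω * M (k + 1) ω i) atTop (𝓝 l))
    (hK : BddAbove (Set.range fun n => K n ω))
    (hbias : ∀ n, ‖ε (n + 1) ω‖ ≤ δ (n + 1) ω * (1 + ‖x n ω‖))
    (hδ : Tendsto (fun n => δ n ω) atTop (𝓝 0)) {Δ : ℝ} (hΔ : 0 < Δ)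
    (hfreq : ∀ i : Fin d, Δ ≤ liminf (fun n : ℕ => (updateCount Y n i ω : ℝ) / n) atTop)
    (hbal : ∀ (q : ℕ) (i j : Fin d), ∃ l : ℝ, Tendsto (fun n : ℕ =>
        (∑ k ∈ Finset.Icc (updateCount Y n i ω)
          (updateCount Y (window α n (1 / (q + 1))) i ω), α k) /
          ∑ k ∈ Finset.Icc (updateCount Y n j ω)
            (updateCount Y (window α n (1 / (q + 1))) j ω), α k) atTop (𝓝 l)) :
    ∃ B : ℝ, ∀ n, ‖x n ω‖ ≤ B := by
  have hd' : (0 : ℝ) < d := by exact_mod_cast hd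
  have hg0 := hDrift.gas.equilibrium
  have hdT : 0 < d * T := by positivity
  obtain ⟨ρ, hρ, hρ1, hν⟩ := exists_linear_lower_bound hΔ hfreq
  obtain ⟨C, hC, hCev⟩ :=
    exists_updateStep_bounds hStep (fun n => hAlg.nonempty n ω) hρ hρ1 hν
  -- A window overshoots `d * T` by at most one step, eventually at most `1`; effective steps cost
  -- the factor `C`.
  set S : ℝ := C * (d * T + 1) with hSdef
  have hS : 0 ≤ S := by positivity
  set B : ℝ := Real.exp (L * S) with hB
  have hB0 : 0 < B := Real.exp_pos _
  set E : ℝ := (1 + 2 * S + L * B + 2 * (L ^ 2 * B * S)) * Real.exp (L * S) with hE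
  have hE0 : 0 < E := by positivity
  set η : ℝ := 1 / (4 * E) with hηdef
  have hη0 : 0 < η := by positivity
  have hηE : η * (1 + 2 * S + L * B + 2 * (L ^ 2 * B * S)) * Real.exp (L * S) ≤ 1 / 4 := by
    rw [mul_assoc, ← hE, hηdef]
    exact le_of_eq (by field_simp)
  obtain ⟨R, hR1, hR⟩ : ∃ R : ℝ, 1 ≤ R ∧ ∀ r ≥ R, ∀ u : Fin d → ℝ, ‖u‖ ≤ B + 1 →
      ‖r⁻¹ • h (r • u) - hInf u‖ ≤ η := by
    have h1 := Metric.tendstoUniformlyOn_iff.1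
      (hDrift.scaling_limit _ (isCompact_closedBall 0 (B + 1))) η hη0
    obtain ⟨R, hR⟩ := eventually_atTop.1 h1
    refine ⟨max R 1, le_max_right _ _, fun r hr u hu => ?_⟩
    have := hR r ((le_max_left _ _).trans hr) u (by simpa using hu)
    rw [dist_comm, dist_eq_norm] at this
    exact this.le
  obtain ⟨κ, hκ⟩ := hK
  -- `κ` and `R` are fixed only along the path, so noise convergence is needed for every natural
  -- `q`. The weights normalize by `max ‖x s‖ 1`, independent of `R`; passing to `r` costs at most a
  -- factor `R`.
  obtain ⟨q, hq⟩ := exists_nat_ge (max κ ((B + 1) * R))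
  have hasync := eventually_abs_clock_diff_le hStep hρ hρ1 hν hC (hCev.mono fun n h => h.1) hbal
    hη0 (d * T + 1)
  have hnoiseev : ∀ᶠ n in atTop, ∀ i : Fin d, ∀ m ≥ n, |∑ k ∈ Finset.Ico n m,
      noiseWeight α (d * T) Y x K q i k ω * M (k + 1) ω i| ≤ η := by
    rw [eventually_all]
    intro i
    obtain ⟨l, hl⟩ := hnoise q i
    exact eventually_abs_sum_Ico_le hl hη0
  have hδ' : ∀ᶠ n in atTop, δ (n + 1) ω < η / (B + 2) :=
    ((tendsto_add_atTop_iff_nat 1).2 hδ).eventually_lt_const (by positivity)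
  obtain ⟨N, hN⟩ := eventually_atTop.1 (hCev.and (hδ'.and
    ((hStep.tendsto_zero.eventually_le_const one_pos).and
      (hStep.tendsto_zero.eventually_le_const (div_pos hη0 hC)))))
  obtain ⟨N', hN'⟩ := eventually_atTop.1 (hasync.and hnoiseev)
  -- Allowing `m = n + 1` includes the first index of the next window, where the contraction is
  -- needed.
  have hwin : ∀ n, max N N' ≤ windowStart α (d * T) n → ∀ m, windowStart α (d * T) n ≤ m →
      m ≤ n + 1 → ‖x m ω‖ ≤ (B + 1) * max ‖x (windowStart α (d * T) n) ω‖ R ∧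
        (d * T ≤ ∑ k ∈ Finset.Ico (windowStart α (d * T) n) m, α k →
          ‖x m ω‖ ≤ max ‖x (windowStart α (d * T) n) ω‖ R / 2) := by
    intro n hn m hm hmn
    set s := windowStart α (d * T) n with hs
    set r := max ‖x s ω‖ R with hr
    have hsn : s ≤ n := windowStart_le _ _ _
    have hNs : N ≤ s := (le_max_left _ _).trans hn
    obtain ⟨hasy, hnoi⟩ := hN' s ((le_max_right _ _).trans hn)
    have hr1 : 1 ≤ r := hR1.trans (le_max_right _ _)
    have hlen : ∑ k ∈ Finset.Ico s (n + 1), α k ≤ d * T + 1 := by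
      rw [Finset.sum_Ico_succ_top hsn]
      exact add_le_add (sum_windowStart_lt hdT n).le (hN n (hNs.trans hsn)).2.2.1
    have hlen' : ∀ k ≤ n + 1 - s, ∑ j ∈ Finset.Ico s (s + k), α j ≤ d * T + 1 := fun k hk =>
      (Finset.sum_le_sum_of_subset_of_nonneg (Finset.Ico_subset_Ico_right (by omega))
        fun j _ _ => (hStep.pos j).le).trans hlen
    have key := norm_le_on_window hd (h := h) hg hg0 hT (x := fun n => x n ω)
      (M := fun n => M n ω) (ε := fun n => ε n ω) (β := fun n i => updateStep α Y n i ω)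
      (α := α) (C := C) (S := S) (B := B) (η := η) (r := r) (n₀ := s) (p := n + 1 - s)
      hS hB hη0 hηE hr1 (le_max_left _ _) (hR r (le_max_right _ _))
      (fun n i => hAlg.update_eq n ω i)
      (fun n hn i => ⟨updateStep_nonneg hStep.pos n, (hN n (hNs.trans hn)).1.1 i⟩)
      (fun n hn => (hN n (hNs.trans hn)).1.2)
      (fun n hn => by
        have := (hN n (hNs.trans hn)).2.2.2
        rwa [le_div_iff₀ hC, mul_comm] at this)
      (fun n hn => by
        have h1 := (hN n (hNs.trans hn)).2.1
        rw [lt_div_iff₀ (by positivity)] at h1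
        calc ‖ε (n + 1) ω‖ * (B + 2) ≤ δ (n + 1) ω * (1 + ‖x n ω‖) * (B + 2) := by
              gcongr
              exact hbias n
          _ = δ (n + 1) ω * (B + 2) * (1 + ‖x n ω‖) := by ring
          _ ≤ η * (1 + ‖x n ω‖) := by gcongr)
      (fun k hk i j => by
        have := hasy i j (s + k) (by omega) (hlen' k hk)
        rwa [Finset.sum_Ico_eq_sum_range, add_tsub_cancel_left] at this)
      (by
        have := hlen' _ le_rfl
        rw [Finset.sum_Ico_eq_sum_range, add_tsub_cancel_left] at this
        rw [hSdef]
        gcongr)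
      (fun k hk htrunc i => by
        set r₁ := max ‖x s ω‖ 1 with hr₁
        have hr₁0 : 0 < r₁ := lt_of_lt_of_le one_pos (le_max_right _ _)
        have hrr : r₁ ≤ r := max_le_max le_rfl hR1
        have hrR : r ≤ R * r₁ := max_le
          ((le_max_left _ _).trans (le_mul_of_one_le_left hr₁0.le hR1))
          (le_mul_of_one_le_right (by linarith) (le_max_right _ _))
        have hw := hnoi i (s + k) (by omega)
        rw [Finset.sum_Ico_eq_sum_range, add_tsub_cancel_left] at hw
        have heq : ∑ j ∈ Finset.range k, updateStep α Y (s + j) i ω * M (s + j + 1) ω i =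
            r₁ * ∑ j ∈ Finset.range k,
              noiseWeight α (d * T) Y x K q i (s + j) ω * M (s + j + 1) ω i := by
          rw [Finset.mul_sum]
          refine Finset.sum_congr rfl fun j hj => ?_
          have hjk := Finset.mem_range.1 hj
          have hws : windowStart α (d * T) (s + j) = s :=
            windowStart_eq_of_mem (by omega) (by omega)
          have hcond : ‖x (s + j) ω‖ ≤ q * r₁ ∧ K (s + j) ω ≤ q := by
            constructor
            · calc _ ≤ (B + 1) * r := htrunc j hjk
                _ ≤ (B + 1) * (R * r₁) := by gcongr
                _ = (B + 1) * R * r₁ := by ring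
                _ ≤ q * r₁ := by
                    gcongr
                    exact (le_max_right _ _).trans hq
            · exact (hκ ⟨_, rfl⟩).trans ((le_max_left _ _).trans hq)
          rw [noiseWeight, hws, if_pos hcond, ← hr₁]
          field_simp
        rw [heq, abs_mul, abs_of_pos hr₁0, mul_comm η]
        gcongr)
      (m - s) (by omega)
    rw [Nat.add_sub_cancel' hm] at key
    rwa [Finset.sum_Ico_eq_sum_range]
  obtain ⟨n₁, hn₁⟩ := eventually_atTop.1
    ((tendsto_windowStart hStep.sum_eq_top hdT).eventually_ge_atTop (max N N'))
  set B₁ : ℝ := max ‖x (windowStart α (d * T) n₁) ω‖ R with hB₁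
  -- At each new window the norm is at most half the previous maximum, so the maximum with `R`
  -- cannot increase.
  have hstart : ∀ n ≥ n₁, max ‖x (windowStart α (d * T) n) ω‖ R ≤ B₁ := by
    intro n hn
    induction n, hn using Nat.le_induction with
    | base => exact le_rfl
    | succ n hn ih =>
      rcases windowStart_succ (α := α) (T := d * T) n with ⟨h1, h2⟩ | ⟨h1, -⟩
      · rw [h1]
        have h3 := (hwin n (hn₁ n hn) (n + 1)
          ((windowStart_le _ _ _).trans (Nat.le_succ n)) le_rfl).2 h2
        refine max_le (h3.trans ?_) (le_max_right _ _)
        have h0 : 0 ≤ max ‖x (windowStart α (d * T) n) ω‖ R :=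
          (norm_nonneg _).trans (le_max_left _ _)
        linarith
      · rwa [h1]
  obtain ⟨B₂, hB₂⟩ := ((Finset.range n₁).image fun n => ‖x n ω‖).bddAbove
  refine ⟨max B₂ ((B + 1) * B₁), fun n => ?_⟩
  rcases lt_or_ge n n₁ with h1 | h1
  · exact le_max_of_le_left (hB₂ (Finset.mem_coe.2
      (Finset.mem_image.2 ⟨n, Finset.mem_range.2 h1, rfl⟩)))
  · refine le_max_of_le_right ?_
    refine (hwin n (hn₁ n h1) n (windowStart_le _ _ _) (Nat.le_succ n)).1.trans ?_
    gcongr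
    exact hstart n h1

end Path

end AsyncSA

theorem mainTheorem1 {Ω : Type*} {mΩ : MeasurableSpace Ω} (μ : Measure Ω) [IsProbabilityMeasure μ]
    (F : Filtration ℕ mΩ) {d : ℕ} (α : ℕ → ℝ) (h hInf : (Fin d → ℝ) → (Fin d → ℝ))
    (Y : ℕ → Ω → Finset (Fin d)) (M ε x : ℕ → Ω → Fin d → ℝ) (K δ : ℕ → Ω → ℝ)
    (hAlg : AsyncSA.IsAsyncSA F α h Y M ε x)
    (hDrift : AsyncSA.DriftCondition h hInf)
    (hNoise : AsyncSA.NoiseCondition μ F M ε x K δ)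
    (hStep : AsyncSA.StepsizeCondition α)
    (hAsync : AsyncSA.AsynchronyCondition μ α Y) :
    ∀ᵐ ω ∂μ, ∃ C : ℝ, ∀ n : ℕ, ‖x n ω‖ ≤ C := by
  obtain ⟨L, hL⟩ := hDrift.lipschitz
  have hg := hDrift.lipschitzWith_hInf hL
  obtain ⟨T, hT0, hT⟩ := hDrift.gas.exists_uniform_time hg (ε := 1 / 4) (by norm_num)
  obtain ⟨Δ, hΔ, hfreq⟩ := hAsync.frequency
  have hnoise : ∀ᵐ ω ∂μ, ∀ (q : ℕ) (i : Fin d), ∃ l, Tendsto (fun n => ∑ k ∈ Finset.range n,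
      AsyncSA.noiseWeight α (d * T) Y x K q i k ω * M (k + 1) ω i) atTop (𝓝 l) :=
    ae_all_iff.2 fun q => ae_all_iff.2 fun i =>
      AsyncSA.ae_exists_tendsto_noise hAlg hNoise hStep (d * T) q i
  -- The exceptional null set depends on the window length. Lengths `1 / (q + 1)` suffice and are
  -- countably many.
  have hbal := ae_all_iff.2 fun q : ℕ => ae_all_iff.2 fun i => ae_all_iff.2 fun j =>
    hAsync.balance (1 / (q + 1)) (by positivity) i j
  filter_upwards [hnoise, hbal, ae_all_iff.2 hfreq, ae_all_iff.2 hNoise.bias_le,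
    hNoise.K_bounded, hNoise.δ_tendsto] with ω h1 h2 h3 h4 h5 h6
  have hd : 0 < d := by
    obtain ⟨i, -⟩ := hAlg.nonempty 0 ω
    exact i.pos
  exact AsyncSA.exists_norm_le_of_path hd hAlg hStep hDrift hg hT0 hT h1 h5 h4 h6 hΔ h3 h2
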